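/- Let $G=\mathrm{SL}_2(\mathbb C)$, let $B\subset G$ be the subgroup of upper triangular matrices, $N\subset B$ the subgroup of unipotent upper triangular matrices and $H\subset G$ the subgroup of diagonal matrices $\mathrm{diag}(a,a^{-1})$. Let $\mathfrak g=\mathfrak{sl}_2(\mathbb C)$ with standard basis $e,f,h$, and $\mathfrak h=\mathbb C h$. Identify $\widetilde X=G/N$ with $\mathbb C^2\setminus\{0\}$, with coordinates $x_1,x_2$, through the first column of a matrix, and identify $X=G/B$ with $\mathbb P^1$; let $\pi:\widetilde X\to X$ be the projection. The group $G$ acts on $\widetilde X$ on the left by left multiplication, and $H$ acts on the right by right multiplication, i.e. $v\cdot\mathrm{diag}(a,a^{-1})=av$. Let $\mathcal D_{\widetilde X}$ be the sheaf of differential operators on $\widetilde X$, and let $\widetilde{\mathcal D}=[\pi_*\mathcal D_{\widetilde X}]^H$ be the sheaf on $X$ with $\widetilde{\mathcal D}(U)=\mathcal D_{\widetilde X}(\pi^{-1}(U))^H$, where $H$ acts on functions by $(t\cdot\varphi)(v)=\varphi(v\cdot t)$ and on differential operators by $(t\cdot\theta)(t\cdot\varphi)=t\cdot\theta(\varphi)$.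 Let $\mathcal Z(\mathfrak g)$ be the centre of $\mathcal U(\mathfrak g)$, let $\gamma_{\mathrm{HC}}:\mathcal U(\mathfrak g)\to\mathcal U(\mathfrak h)$ be the projection onto the first summand of $\mathcal U(\mathfrak g)=\mathcal U(\mathfrak h)\oplus\bigl(f\,\mathcal U(\mathfrak g)+\mathcal U(\mathfrak g)\,e\bigr)$, and put $\widetilde{\mathcal U}=\mathcal U(\mathfrak g)\otimes_{\mathcal Z(\mathfrak g)}\mathcal U(\mathfrak h)$, where $\mathcal Z(\mathfrak g)$ acts on $\mathcal U(\mathfrak h)$ through $\gamma_{\mathrm{HC}}$. For $x\in\mathfrak g$ and $y\in\mathfrak h$ let $L_x$ and $R_y$ be the operators $$L_x\varphi(v)=\tfrac{d}{dt}\Big|_{t=0}\varphi(\exp(tx)^{-1}v),\qquad R_y\varphi(v)=\tfrac{d}{dt}\Big|_{t=0}\varphi(v\exp(ty)).$$ **Theorem.** There is a unique homomorphism of $\mathbb C$-algebras $\alpha:\widetilde{\mathcal U}\to\Gamma(X,\widetilde{\mathcal D})$ with $\alpha(x\otimes1)=L_x$ for all $x\in\mathfrak g$ and $\alpha(1\otimes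 y)=R_y$ for all $y\in\mathfrak h$, and $\alpha$ is an isomorphism. Moreover, the algebra $\Gamma(X,\widetilde{\mathcal D})$ is generated by the operators $x_i\partial_j$ with $i,j\in\{1,2\}$, and $$L_e=-x_2\partial_1,\quad L_f=-x_1\partial_2,\quad L_h=-x_1\partial_1+x_2\partial_2,\quad R_h=x_1\partial_1+x_2\partial_2 .$$ -/

import Mathlib

noncomputable section

namespace SL2Loc

attribute [local instance 100] LieRing.ofAssociativeRing

/-! ### The Lie algebra `𝔤 = 𝔰𝔩₂(ℂ)` and its enveloping algebra -/

/-- `𝔤 = 𝔰𝔩₂(ℂ)`: the traceless complex `2 × 2` matrices. -/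
abbrev 𝔤 : Type := LieAlgebra.SpecialLinear.sl (Fin 2) ℂ

/-- The standard basis of `𝔤`. -/
def e : 𝔤 := ⟨!![0, 1; 0, 0], by simp [LieAlgebra.SpecialLinear.sl, Matrix.trace]⟩
def f : 𝔤 := ⟨!![0, 0; 1, 0], by simp [LieAlgebra.SpecialLinear.sl, Matrix.trace]⟩
def h : 𝔤 := ⟨!![1, 0; 0, -1], by simp [LieAlgebra.SpecialLinear.sl, Matrix.trace]⟩

/-- The Cartan subalgebra `𝔥 = ℂ h`. -/
def 𝔥 : LieSubalgebra ℂ 𝔤 :=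
  { Submodule.span ℂ {h} with
    lie_mem' := by
      intro x y hx hy
      obtain ⟨a, rfl⟩ := Submodule.mem_span_singleton.1 hx
      obtain ⟨b, rfl⟩ := Submodule.mem_span_singleton.1 hy
      simp }

/-- `h` as an element of `𝔥`. -/
def h𝔥 : 𝔥 := ⟨h, Submodule.mem_span_singleton_self h⟩

/-- The universal enveloping algebras `U(𝔤)` and `U(𝔥)`. -/
abbrev U𝔤 : Type := UniversalEnvelopingAlgebra ℂ 𝔤
abbrev U𝔥 : Type := UniversalEnvelopingAlgebra ℂ 𝔥

/-- The canonical maps `𝔤 → U(𝔤)` and `𝔥 → U(𝔥)`. -/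
abbrev ι𝔤 : 𝔤 →ₗ⁅ℂ⁆ U𝔤 := UniversalEnvelopingAlgebra.ι ℂ
abbrev ι𝔥 : 𝔥 →ₗ⁅ℂ⁆ U𝔥 := UniversalEnvelopingAlgebra.ι ℂ

/-- The algebra homomorphism `U(𝔥) → U(𝔤)` induced by the inclusion `𝔥 ⊆ 𝔤`. -/
def inclU : U𝔥 →ₐ[ℂ] U𝔤 := UniversalEnvelopingAlgebra.lift ℂ (ι𝔤.comp 𝔥.incl)

/-- The subspace `𝔫⁻ U(𝔤) + U(𝔤) 𝔫` of `U(𝔤)`, where `𝔫⁻ = ℂ f` and `𝔫 = ℂ e`. -/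
def nilPart : Submodule ℂ U𝔤 :=
  LinearMap.range (LinearMap.mulLeft ℂ (ι𝔤 f)) ⊔ LinearMap.range (LinearMap.mulRight ℂ (ι𝔤 e))

theorem inclU_ι (y : 𝔥) : inclU (ι𝔥 y) = ι𝔤 y := by
  simp [inclU]

theorem lie_e_f : ⁅e, f⁆ = h := by
  apply Subtype.ext; rw [LieAlgebra.SpecialLinear.sl_bracket]; simp [e, f, h]
theorem lie_h_e : ⁅h, e⁆ = (2 : ℂ) • e := by
  apply Subtype.ext; rw [LieAlgebra.SpecialLinear.sl_bracket]; simp [e, h, one_add_one_eq_two]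
theorem lie_h_f : ⁅h, f⁆ = (-2 : ℂ) • f := by
  apply Subtype.ext; rw [LieAlgebra.SpecialLinear.sl_bracket]; simp [f, h, Matrix.vecHead, Matrix.vecTail]; norm_num

theorem eq_basis (x : 𝔤) : x = x.1 0 1 • e + x.1 1 0 • f + x.1 0 0 • h := by
  have hx : x.1 1 1 = - x.1 0 0 := by
    have := x.2
    simp [LieAlgebra.SpecialLinear.sl, Matrix.trace] at this
    linear_combination this
  apply Subtype.ext
  ext i j
  fin_cases i <;> fin_cases j <;> simp [e, f, h, hx]

theorem comm_e_f : ι𝔤 e * ι𝔤 f = ι𝔤 f * ι𝔤 e + ι𝔤 h := by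
  have := LieHom.map_lie ι𝔤 e f
  rw [lie_e_f, LieRing.of_associative_ring_bracket] at this
  rw [this]; abel
theorem comm_h_e : ι𝔤 h * ι𝔤 e = ι𝔤 e * ι𝔤 h + (2 : ℂ) • ι𝔤 e := by
  have := LieHom.map_lie ι𝔤 h e
  rw [lie_h_e, LieRing.of_associative_ring_bracket, map_smul] at this
  rw [this]; abel
theorem comm_h_f : ι𝔤 h * ι𝔤 f = ι𝔤 f * ι𝔤 h + (-2 : ℂ) • ι𝔤 f := by
  have := LieHom.map_lie ι𝔤 h f
  rw [lie_h_f, LieRing.of_associative_ring_bracket, map_smul] at this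
  rw [this]; abel

theorem adjoin_ι (L : Type) [LieRing L] [LieAlgebra ℂ L] :
    Algebra.adjoin ℂ (Set.range (UniversalEnvelopingAlgebra.ι ℂ : L → _)) = ⊤ := by
  set S := Algebra.adjoin ℂ (Set.range (UniversalEnvelopingAlgebra.ι ℂ : L → _)) with hS
  let i : L →ₗ⁅ℂ⁆ S :=
    { toFun := fun x => ⟨UniversalEnvelopingAlgebra.ι ℂ x, Algebra.subset_adjoin ⟨x, rfl⟩⟩
      map_add' := fun x y => Subtype.ext (by simp)
      map_smul' := fun c x => Subtype.ext (by simp)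
      map_lie' := fun {x y} => Subtype.ext (by
        simp [LieRing.of_associative_ring_bracket]) }
  have key : S.val.comp (UniversalEnvelopingAlgebra.lift ℂ i) = AlgHom.id ℂ _ := by
    apply UniversalEnvelopingAlgebra.hom_ext
    ext x
    simp [i]
  rw [eq_top_iff]
  intro u _
  have := DFunLike.congr_fun key u
  rw [AlgHom.id_apply] at this
  rw [← this]
  exact (UniversalEnvelopingAlgebra.lift ℂ i u).2

/-- Every element of `U(𝔥)` is a polynomial in `h`. -/
theorem exists_poly (c : U𝔥) : ∃ p : Polynomial ℂ, c = Polynomial.aeval (ι𝔥 h𝔥) p := by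
  have hc : c ∈ Algebra.adjoin ℂ (Set.range (UniversalEnvelopingAlgebra.ι ℂ : 𝔥 → U𝔥)) := by
    rw [adjoin_ι]; trivial
  have hle : Algebra.adjoin ℂ (Set.range (UniversalEnvelopingAlgebra.ι ℂ : 𝔥 → U𝔥)) ≤
      (Polynomial.aeval (R := ℂ) (ι𝔥 h𝔥)).range := by
    refine Algebra.adjoin_le ?_
    rintro _ ⟨y, rfl⟩
    obtain ⟨a, ha⟩ := Submodule.mem_span_singleton.1 y.2
    have hy : y = a • h𝔥 := Subtype.ext ha.symm
    refine ⟨Polynomial.C a * Polynomial.X, ?_⟩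
    simp [hy, Algebra.smul_def]
  obtain ⟨p, hp⟩ := hle hc
  exact ⟨p, hp.symm⟩

theorem U𝔥_mul_comm (a b : U𝔥) : a * b = b * a := by
  obtain ⟨p, rfl⟩ := exists_poly a
  obtain ⟨q, rfl⟩ := exists_poly b
  rw [← map_mul, ← map_mul, mul_comm]

/-! The universal Verma module, used to see that the sum `U(𝔥) + (𝔫⁻ U(𝔤) + U(𝔤) 𝔫)` is direct. -/

open Polynomial in
def vermaE : Module.End ℂ (ℕ → ℂ[X]) where
  toFun a k := ((k : ℂ[X]) + 1) * (X - (k : ℂ[X])) * a (k + 1)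
  map_add' a b := by ext1 k; simp [mul_add]
  map_smul' c a := by ext1 k; simp

open Polynomial in
def vermaF : Module.End ℂ (ℕ → ℂ[X]) where
  toFun a k := if k = 0 then 0 else a (k - 1)
  map_add' a b := by ext1 k; by_cases hk : k = 0 <;> simp [hk]
  map_smul' c a := by ext1 k; by_cases hk : k = 0 <;> simp [hk]

open Polynomial in
def vermaH : Module.End ℂ (ℕ → ℂ[X]) where
  toFun a k := (X - 2 * (k : ℂ[X])) * a k
  map_add' a b := by ext1 k; simp [mul_add]
  map_smul' c a := by ext1 k; simp

open Polynomial in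
theorem verma_ef : vermaE * vermaF - vermaF * vermaE = vermaH := by
  ext1 a; ext1 k
  rcases k with _ | k
  · simp [vermaE, vermaF, vermaH]
  · simp [vermaE, vermaF, vermaH]; ring

open Polynomial in
theorem verma_he : vermaH * vermaE - vermaE * vermaH = (2 : ℂ) • vermaE := by
  ext1 a; ext1 k
  simp [vermaE, vermaH, two_smul]; ring

open Polynomial in
theorem verma_hf : vermaH * vermaF - vermaF * vermaH = (-2 : ℂ) • vermaF := by
  ext1 a; ext1 k
  rcases k with _ | k <;> simp [vermaF, vermaH, two_smul]; ring

open Polynomial in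
def verma : 𝔤 →ₗ⁅ℂ⁆ Module.End ℂ (ℕ → ℂ[X]) where
  toFun x := x.1 0 1 • vermaE + x.1 1 0 • vermaF + x.1 0 0 • vermaH
  map_add' x y := by simp [add_smul]; abel
  map_smul' c x := by simp [mul_smul]
  map_lie' := by
    intro x y
    rw [LieAlgebra.SpecialLinear.sl_bracket]
    have hx : x.1 1 1 = - x.1 0 0 := by
      have := x.2
      simp [LieAlgebra.SpecialLinear.sl, Matrix.trace] at this
      linear_combination this
    have hy : y.1 1 1 = - y.1 0 0 := by
      have := y.2
      simp [LieAlgebra.SpecialLinear.sl, Matrix.trace] at this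
      linear_combination this
    have h1 : vermaE * vermaF = vermaF * vermaE + vermaH := by rw [← verma_ef]; abel
    have h2 : vermaH * vermaE = vermaE * vermaH + (2 : ℂ) • vermaE := by rw [← verma_he]; abel
    have h3 : vermaH * vermaF = vermaF * vermaH + (-2 : ℂ) • vermaF := by rw [← verma_hf]; abel
    simp only [LieRing.of_associative_ring_bracket, Matrix.sub_apply, Matrix.mul_apply,
      Fin.sum_univ_two, hx, hy, mul_add, add_mul, smul_mul_smul_comm, h1, h2, h3]
    module

theorem inclU_mem_nilPart {c : U𝔥} (hc : inclU c ∈ nilPart) : c = 0 := by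
  obtain ⟨p, rfl⟩ := exists_poly c
  let ρ : U𝔤 →ₐ[ℂ] Module.End ℂ (ℕ → Polynomial ℂ) := UniversalEnvelopingAlgebra.lift ℂ verma
  have hρ : ∀ x, ρ (ι𝔤 x) = verma x := fun x => by simp [ρ]
  have he : ρ (ι𝔤 e) = vermaE := by rw [hρ]; simp [verma, e]
  have hf : ρ (ι𝔤 f) = vermaF := by rw [hρ]; simp [verma, f]
  have hh : ρ (ι𝔤 h) = vermaH := by rw [hρ]; simp [verma, h]
  have key : ∀ (q : Polynomial ℂ) (a : ℕ → Polynomial ℂ),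
      ρ (inclU (Polynomial.aeval (ι𝔥 h𝔥) q)) a 0 = q * a 0 := by
    intro q
    induction q using Polynomial.induction_on' with
    | add p q hp hq => intro a; simp [-UniversalEnvelopingAlgebra.ι_apply, hp, hq, add_mul]
    | monomial n c =>
      have hn : ∀ (n : ℕ) (a : ℕ → Polynomial ℂ), (vermaH ^ n) a 0 = Polynomial.X ^ n * a 0 := by
        intro n
        induction n with
        | zero => intro a; simp
        | succ n ih => intro a; rw [pow_succ, Module.End.mul_apply, ih]; simp [vermaH]; ring
      intro a
      have h1 : ρ (inclU (ι𝔥 h𝔥)) = vermaH := by rw [inclU_ι]; exact hh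
      simp [-UniversalEnvelopingAlgebra.ι_apply, map_mul, map_pow, h1, hn, Module.algebraMap_end_apply,
        ← Polynomial.C_mul_X_pow_eq_monomial, Polynomial.smul_eq_C_mul, mul_assoc]
  obtain ⟨_, ⟨u, rfl⟩, _, ⟨v, rfl⟩, huv⟩ := Submodule.mem_sup.1 hc
  have h0 := key p (Pi.single 0 1)
  rw [← huv] at h0
  have hE0 : vermaE (Pi.single 0 1) = 0 := by
    ext1 k; simp [vermaE]
  have : p = 0 := by
    simpa [-UniversalEnvelopingAlgebra.ι_apply, he, hf, hE0, vermaF] using h0.symm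
  simp [this]

theorem inclU_injective : Function.Injective inclU := by
  rw [injective_iff_map_eq_zero]
  intro c hc
  exact inclU_mem_nilPart (hc ▸ zero_mem _)

theorem e_mul_inclU (c : U𝔥) : ∃ c', ι𝔤 e * inclU c = inclU c' * ι𝔤 e := by
  have key : ∀ c ∈ (⊤ : Subalgebra ℂ U𝔥), ∃ c', ι𝔤 e * inclU c = inclU c' * ι𝔤 e := by
    rw [← adjoin_ι]
    intro c hc
    induction hc using Algebra.adjoin_induction with
    | mem x hx =>
      obtain ⟨y, rfl⟩ := hx
      obtain ⟨a, ha⟩ := Submodule.mem_span_singleton.1 y.2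
      refine ⟨ι𝔥 y - algebraMap ℂ _ (2 * a), ?_⟩
      rw [map_sub, inclU_ι, ← ha, map_smul, AlgHom.commutes, sub_mul, smul_mul_assoc,
        comm_h_e, ← Algebra.smul_def, mul_smul_comm]
      module
    | algebraMap r => exact ⟨algebraMap ℂ _ r, by simp [Algebra.commutes]⟩
    | add a b _ _ ha hb =>
      obtain ⟨a', ha⟩ := ha
      obtain ⟨b', hb⟩ := hb
      exact ⟨a' + b', by simp [-UniversalEnvelopingAlgebra.ι_apply, mul_add, add_mul, ha, hb]⟩
    | mul a b _ _ ha hb =>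
      obtain ⟨a', ha⟩ := ha
      obtain ⟨b', hb⟩ := hb
      exact ⟨a' * b', by rw [map_mul, ← mul_assoc, ha, mul_assoc, hb, ← mul_assoc, map_mul]⟩
  exact key c trivial

theorem inclU_mul_f (c : U𝔥) : ∃ c', inclU c * ι𝔤 f = ι𝔤 f * inclU c' := by
  have key : ∀ c ∈ (⊤ : Subalgebra ℂ U𝔥), ∃ c', inclU c * ι𝔤 f = ι𝔤 f * inclU c' := by
    rw [← adjoin_ι]
    intro c hc
    induction hc using Algebra.adjoin_induction with
    | mem x hx =>
      obtain ⟨y, rfl⟩ := hx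
      obtain ⟨a, ha⟩ := Submodule.mem_span_singleton.1 y.2
      refine ⟨ι𝔥 y - algebraMap ℂ _ (2 * a), ?_⟩
      rw [map_sub, inclU_ι, ← ha, map_smul, AlgHom.commutes, mul_sub, smul_mul_assoc,
        comm_h_f, ← Algebra.commutes, ← Algebra.smul_def, mul_smul_comm]
      module
    | algebraMap r => exact ⟨algebraMap ℂ _ r, by simp [Algebra.commutes]⟩
    | add a b _ _ ha hb =>
      obtain ⟨a', ha⟩ := ha
      obtain ⟨b', hb⟩ := hb
      exact ⟨a' + b', by simp [-UniversalEnvelopingAlgebra.ι_apply, mul_add, add_mul, ha, hb]⟩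
    | mul a b _ _ ha hb =>
      obtain ⟨a', ha⟩ := ha
      obtain ⟨b', hb⟩ := hb
      exact ⟨a' * b', by rw [map_mul, mul_assoc, hb, ← mul_assoc, ha, mul_assoc, map_mul]⟩
  exact key c trivial

theorem codisjoint_inclU : Codisjoint (LinearMap.range inclU.toLinearMap) nilPart := by
  let T : Submodule ℂ U𝔤 :=
    Submodule.span ℂ {u | ∃ (a k : ℕ) (c : U𝔥), u = ι𝔤 f ^ a * inclU c * ι𝔤 e ^ k}
  have hT : ∀ (a k : ℕ) (c : U𝔥), ι𝔤 f ^ a * inclU c * ι𝔤 e ^ k ∈ T :=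
    fun a k c => Submodule.subset_span ⟨a, k, c, rfl⟩
  have ext : ∀ x : U𝔤, (∀ (a k : ℕ) (c : U𝔥), x * (ι𝔤 f ^ a * inclU c * ι𝔤 e ^ k) ∈ T) →
      ∀ t ∈ T, x * t ∈ T := by
    intro x hx t ht
    induction ht using Submodule.span_induction with
    | mem t ht => obtain ⟨a, k, c, rfl⟩ := ht; exact hx a k c
    | zero => simp
    | add s t _ _ hs ht => rw [mul_add]; exact T.add_mem hs ht
    | smul r t _ ht => rw [mul_smul_comm]; exact T.smul_mem r ht
  have hF : ∀ t ∈ T, ι𝔤 f * t ∈ T := ext _ fun a k c => by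
    have := hT (a + 1) k c
    rwa [pow_succ', mul_assoc, mul_assoc, ← mul_assoc _ _ (ι𝔤 e ^ k)] at this
  have hH : ∀ t ∈ T, ι𝔤 h * t ∈ T := ext _ fun a k c => by
    induction a with
    | zero =>
      have := hT 0 k (ι𝔥 h𝔥 * c)
      rw [map_mul, inclU_ι] at this
      simpa [mul_assoc, h𝔥] using this
    | succ a ih =>
      have h1 : ι𝔤 h * (ι𝔤 f ^ (a + 1) * inclU c * ι𝔤 e ^ k) =
          ι𝔤 f * (ι𝔤 h * (ι𝔤 f ^ a * inclU c * ι𝔤 e ^ k)) +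
          (-2 : ℂ) • (ι𝔤 f * (ι𝔤 f ^ a * inclU c * ι𝔤 e ^ k)) := by
        calc _ = (ι𝔤 h * ι𝔤 f) * (ι𝔤 f ^ a * inclU c * ι𝔤 e ^ k) := by
              rw [pow_succ']; simp only [mul_assoc]
          _ = _ := by rw [comm_h_f, add_mul, smul_mul_assoc, mul_assoc]
      rw [h1]
      exact T.add_mem (hF _ ih) (T.smul_mem _ (hF _ (hT a k c)))
  have hE : ∀ t ∈ T, ι𝔤 e * t ∈ T := ext _ fun a k c => by
    induction a with
    | zero =>
      obtain ⟨c', hc'⟩ := e_mul_inclU c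
      have := hT 0 (k + 1) c'
      rw [pow_succ', pow_zero, one_mul, ← mul_assoc, ← hc'] at this
      simpa [mul_assoc] using this
    | succ a ih =>
      have h1 : ι𝔤 e * (ι𝔤 f ^ (a + 1) * inclU c * ι𝔤 e ^ k) =
          ι𝔤 f * (ι𝔤 e * (ι𝔤 f ^ a * inclU c * ι𝔤 e ^ k)) +
          ι𝔤 h * (ι𝔤 f ^ a * inclU c * ι𝔤 e ^ k) := by
        calc _ = (ι𝔤 e * ι𝔤 f) * (ι𝔤 f ^ a * inclU c * ι𝔤 e ^ k) := by
              rw [pow_succ']; simp only [mul_assoc]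
          _ = _ := by rw [comm_e_f, add_mul, mul_assoc]
      rw [h1]
      exact T.add_mem (hF _ ih) (hH _ (hT a k c))
  have hall : ∀ u ∈ (⊤ : Subalgebra ℂ U𝔤), ∀ t ∈ T, u * t ∈ T := by
    rw [← adjoin_ι]
    intro u hu
    induction hu using Algebra.adjoin_induction with
    | mem x hx =>
      obtain ⟨y, rfl⟩ := hx
      intro t ht
      obtain ⟨p, q, r, hy⟩ : ∃ p q r : ℂ, y = p • e + q • f + r • h := ⟨_, _, _, eq_basis y⟩
      rw [hy]
      simp only [map_add, map_smul, add_mul, smul_mul_assoc]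
      exact T.add_mem (T.add_mem (T.smul_mem _ (hE t ht)) (T.smul_mem _ (hF t ht)))
        (T.smul_mem _ (hH t ht))
    | algebraMap r => intro t ht; rw [← Algebra.smul_def]; exact T.smul_mem r ht
    | add a b _ _ ha hb => intro t ht; rw [add_mul]; exact T.add_mem (ha t ht) (hb t ht)
    | mul a b _ _ ha hb => intro t ht; rw [mul_assoc]; exact ha _ (hb t ht)
  have hle : T ≤ LinearMap.range inclU.toLinearMap ⊔ nilPart := by
    refine Submodule.span_le.2 ?_
    rintro _ ⟨a, k, c, rfl⟩
    rcases a with _ | a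
    · rcases k with _ | k
      · exact Submodule.mem_sup_left ⟨c, by simp⟩
      · refine Submodule.mem_sup_right (Submodule.mem_sup_right ⟨inclU c * ι𝔤 e ^ k, ?_⟩)
        simp [pow_succ, mul_assoc]
    · refine Submodule.mem_sup_right (Submodule.mem_sup_left
        ⟨ι𝔤 f ^ a * inclU c * ι𝔤 e ^ k, ?_⟩)
      simp [pow_succ', mul_assoc]
  rw [codisjoint_iff, eq_top_iff]
  intro u _
  apply hle
  have h1 : (1 : U𝔤) ∈ T := by simpa using hT 0 0 1
  simpa using hall u trivial 1 h1

/-- The direct sum decomposition `U(𝔤) = U(𝔥) ⊕ (𝔫⁻ U(𝔤) + U(𝔤) 𝔫)`. -/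
theorem isCompl_inclU : IsCompl (LinearMap.range inclU.toLinearMap) nilPart := by
  refine ⟨Submodule.disjoint_def.2 ?_, codisjoint_inclU⟩
  rintro _ ⟨c, rfl⟩ hc
  have : c = 0 := inclU_mem_nilPart hc
  simp [this]

/-- The Harish-Chandra projection `γ_HC : U(𝔤) → U(𝔥)`: the projection onto the first summand of
`U(𝔤) = U(𝔥) ⊕ (𝔫⁻ U(𝔤) + U(𝔤) 𝔫)`. -/
def γHC : U𝔤 →ₗ[ℂ] U𝔥 :=
  LinearMap.linearProjOfIsCompl nilPart inclU.toLinearMap inclU_injective isCompl_inclU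

theorem γHC_inclU (c : U𝔥) : γHC (inclU c) = c :=
  LinearMap.linearProjOfIsCompl_apply_left nilPart inclU.toLinearMap inclU_injective isCompl_inclU c

theorem γHC_of_mem {u : U𝔤} (hu : u ∈ nilPart) : γHC u = 0 :=
  LinearMap.linearProjOfIsCompl_apply_right' nilPart inclU.toLinearMap inclU_injective
    isCompl_inclU u hu

theorem γHC_eq {u : U𝔤} {c : U𝔥} (hu : u - inclU c ∈ nilPart) : γHC u = c := by
  have := γHC_of_mem hu
  rwa [map_sub, γHC_inclU, sub_eq_zero] at this

theorem sub_γHC_mem (u : U𝔤) : u - inclU (γHC u) ∈ nilPart := by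
  have hu : u ∈ LinearMap.range inclU.toLinearMap ⊔ nilPart := by
    rw [codisjoint_iff.1 codisjoint_inclU]; trivial
  obtain ⟨_, ⟨c, rfl⟩, n, hn, rfl⟩ := Submodule.mem_sup.1 hu
  have hc : inclU.toLinearMap c + n - inclU c ∈ nilPart := by simpa using hn
  rw [γHC_eq hc]
  exact hc

/-- The centre `Z(𝔤)` of `U(𝔤)`. -/
abbrev Z𝔤 : Subalgebra ℂ U𝔤 := Subalgebra.center ℂ U𝔤

theorem γHC_mul (z w : Z𝔤) : γHC (z * w : U𝔤) = γHC z * γHC w := by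
  have hA : ∀ n ∈ nilPart, n * (w : U𝔤) ∈ nilPart := by
    intro n hn
    obtain ⟨_, ⟨u, rfl⟩, _, ⟨v, rfl⟩, rfl⟩ := Submodule.mem_sup.1 hn
    rw [add_mul]
    refine nilPart.add_mem (Submodule.mem_sup_left ⟨u * w, ?_⟩)
      (Submodule.mem_sup_right ⟨v * w, ?_⟩)
    · simp [mul_assoc]
    · simp [-UniversalEnvelopingAlgebra.ι_apply, mul_assoc, Subalgebra.mem_center_iff.1 w.2 (ι𝔤 e)]
  have hB : ∀ (c : U𝔥), ∀ n ∈ nilPart, inclU c * n ∈ nilPart := by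
    intro c n hn
    obtain ⟨_, ⟨u, rfl⟩, _, ⟨v, rfl⟩, rfl⟩ := Submodule.mem_sup.1 hn
    obtain ⟨c', hc'⟩ := inclU_mul_f c
    rw [mul_add]
    refine nilPart.add_mem (Submodule.mem_sup_left ⟨inclU c' * u, ?_⟩)
      (Submodule.mem_sup_right ⟨inclU c * v, ?_⟩)
    · simp [-UniversalEnvelopingAlgebra.ι_apply, ← mul_assoc, hc']
    · simp [mul_assoc]
  apply γHC_eq
  have := nilPart.add_mem (hA _ (sub_γHC_mem z)) (hB (γHC z) _ (sub_γHC_mem w))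
  convert this using 1
  rw [map_mul]
  noncomm_ring

/-- The restriction of `γ_HC` to the centre, which is an algebra homomorphism. -/
def γZ : Z𝔤 →ₐ[ℂ] U𝔥 :=
  AlgHom.ofLinearMap (γHC ∘ₗ Z𝔤.val.toLinearMap)
    (by simpa using γHC_inclU 1) (fun z w => γHC_mul z w)

/-- `U(𝔤)` as an algebra over its centre. -/
instance : Algebra Z𝔤 U𝔤 where
  algebraMap := Z𝔤.val.toRingHom
  commutes' z u := (Subalgebra.mem_center_iff.1 z.2 u).symm
  smul_def' _ _ := rfl

/-- `Z(𝔤)` acts on `U(𝔥)` through the Harish-Chandra projection. -/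
instance : Algebra Z𝔤 U𝔥 := γZ.toRingHom.toAlgebra' fun _ _ => U𝔥_mul_comm _ _

/-- The extended universal enveloping algebra `Ũ = U(𝔤) ⊗_{Z(𝔤)} U(𝔥)`. -/
abbrev Utilde : Type := TensorProduct Z𝔤 U𝔤 U𝔥

end SL2Loc

namespace SL2Loc

open TopologicalSpace Matrix TensorProduct

/-! ### Base affine space, the flag variety, and the group actions -/

/-- `G = SL₂(ℂ)`. -/
abbrev G : Type := Matrix.SpecialLinearGroup (Fin 2) ℂ

/-- `H`: the diagonal matrices `diag(a, a⁻¹)` in `G`. -/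
def H : Subgroup G where
  carrier := {g | g 0 1 = 0 ∧ g 1 0 = 0}
  one_mem' := by simp
  mul_mem' := by
    rintro a b ⟨ha, ha'⟩ ⟨hb, hb'⟩
    simp [Matrix.mul_apply, ha, ha', hb, hb']
  inv_mem' := by
    rintro a ⟨ha, ha'⟩
    rw [Matrix.SpecialLinearGroup.SL2_inv_expl]
    exact ⟨by simp [ha], by simp [ha']⟩

theorem H_ne_zero (t : H) : (t : G) 0 0 ≠ 0 := by
  intro h0
  have := (t : G).det_coe
  rw [Matrix.det_fin_two] at this
  simp [h0, t.2.1] at this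

/-- Base affine space `X̃ = G/N`, identified with `ℂ² ∖ {0}` by sending `gN` to the first column
of `g`. -/
def BaseAffine : Type := {v : Fin 2 → ℂ // v ≠ 0}

/-- The left action of `G` on `X̃ = G/N`, by left multiplication. -/
def leftAct (g : G) (v : BaseAffine) : BaseAffine :=
  ⟨(g : Matrix (Fin 2) (Fin 2) ℂ) *ᵥ v.1, fun h0 => v.2 <| by
    have : ((g⁻¹ : G) : Matrix (Fin 2) (Fin 2) ℂ) *ᵥ
      ((g : Matrix (Fin 2) (Fin 2) ℂ) *ᵥ v.1) = v.1 := by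
      rw [Matrix.mulVec_mulVec, ← Matrix.SpecialLinearGroup.coe_mul]; simp
    rw [← this, h0, Matrix.mulVec_zero]⟩

/-- The right action of `H` on `X̃ = G/N`, by right multiplication `gN · t = gtN`: the first column
of `gt` is `t₀₀` times the first column of `g`. -/
def rightAct (v : BaseAffine) (t : H) : BaseAffine :=
  ⟨(t : G) 0 0 • v.1, smul_ne_zero (H_ne_zero t) v.2⟩

/-- The Zariski topology on `ℂ² ∖ {0}`, generated by the sets where a polynomial does not vanish. -/
instance : TopologicalSpace BaseAffine :=
  generateFrom (Set.range fun p : MvPolynomial (Fin 2) ℂ =>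
    {v : BaseAffine | MvPolynomial.eval v.1 p ≠ 0})

/-- The flag variety `X = G/B`, identified with `ℂℙ¹`. -/
def Flag : Type := Projectivization ℂ (Fin 2 → ℂ)

/-- The projection `π : X̃ → X`. -/
def π (v : BaseAffine) : Flag := Projectivization.mk ℂ v.1 v.2

/-- The Zariski topology on `ℂℙ¹`: a set is open if and only if its preimage in `ℂ² ∖ {0}` is. -/
instance : TopologicalSpace Flag := coinduced π inferInstance

/-- The preimage under `π` of an open set. -/
def πInv (U : Opens Flag) : Opens BaseAffine := U.comap ⟨π, continuous_coinduced_rng⟩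

theorem π_rightAct (v : BaseAffine) (t : H) : π (rightAct v t) = π v :=
  (Projectivization.mk_eq_mk_iff' ℂ _ _ _ _).2 ⟨(t : G) 0 0, rfl⟩

theorem eval_rightAct (t : H) (v : BaseAffine) (p : MvPolynomial (Fin 2) ℂ) :
    MvPolynomial.eval (rightAct v t).1 p =
      MvPolynomial.eval v.1
        (MvPolynomial.aeval (fun i => MvPolynomial.C ((t : G) 0 0) * MvPolynomial.X i) p) := by
  rw [← MvPolynomial.coe_aeval_eq_eval, ← MvPolynomial.coe_aeval_eq_eval]
  change _ = (MvPolynomial.aeval v.1) _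
  rw [MvPolynomial.comp_aeval_apply]
  simp [rightAct, Pi.smul_def]

theorem continuous_rightAct (t : H) : Continuous fun v => rightAct v t := by
  refine continuous_generateFrom_iff.2 ?_
  rintro _ ⟨p, rfl⟩
  refine isOpen_generateFrom_of_mem
    ⟨MvPolynomial.aeval (fun i => MvPolynomial.C ((t : G) 0 0) * MvPolynomial.X i) p, ?_⟩
  ext v; simp only [Set.mem_ofPred_eq, Set.mem_preimage, eval_rightAct]

/-- The open set `{v | v · t ∈ W}`. -/
def translate (t : H) (W : Opens BaseAffine) : Opens BaseAffine :=
  W.comap ⟨fun v => rightAct v t, continuous_rightAct t⟩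

/-! ### Regular functions and differential operators -/

/-- The algebra `𝒪(U)` of regular functions on an open subset `U` of `X̃`: the functions which near
every point of `U` are quotients of polynomials. -/
def regSubalgebra (U : Opens BaseAffine) : Subalgebra ℂ (U → ℂ) where
  carrier := {φ | ∀ x : U, ∃ p q : MvPolynomial (Fin 2) ℂ, MvPolynomial.eval x.1.1 q ≠ 0 ∧
    ∀ y : U, MvPolynomial.eval y.1.1 q ≠ 0 →
      φ y = MvPolynomial.eval y.1.1 p / MvPolynomial.eval y.1.1 q}
  mul_mem' := by
    intro a b ha hb x
    obtain ⟨p, q, hq, h1⟩ := ha x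
    obtain ⟨p', q', hq', h2⟩ := hb x
    refine ⟨p * p', q * q', by simp [hq, hq'], fun y hy => ?_⟩
    rw [map_mul] at hy
    rw [Pi.mul_apply, h1 y (left_ne_zero_of_mul hy), h2 y (right_ne_zero_of_mul hy), map_mul,
      map_mul, div_mul_div_comm]
  add_mem' := by
    intro a b ha hb x
    obtain ⟨p, q, hq, h1⟩ := ha x
    obtain ⟨p', q', hq', h2⟩ := hb x
    refine ⟨p * q' + q * p', q * q', by simp [hq, hq'], fun y hy => ?_⟩
    rw [map_mul] at hy
    rw [Pi.add_apply, h1 y (left_ne_zero_of_mul hy), h2 y (right_ne_zero_of_mul hy),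
      div_add_div _ _ (left_ne_zero_of_mul hy) (right_ne_zero_of_mul hy)]
    simp
  algebraMap_mem' := by
    intro c x
    exact ⟨MvPolynomial.C c, 1, by simp, fun y _ => by simp⟩

/-- `𝒪(U)` as a type. -/
def Reg (U : Opens BaseAffine) : Type := regSubalgebra U

instance (U : Opens BaseAffine) : CommRing (Reg U) := inferInstanceAs (CommRing (regSubalgebra U))

instance (U : Opens BaseAffine) : Algebra ℂ (Reg U) :=
  inferInstanceAs (Algebra ℂ (regSubalgebra U))

/-- Restriction of regular functions. -/
def Reg.res {U V : Opens BaseAffine} (hVU : V ≤ U) : Reg U →ₐ[ℂ] Reg V where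
  toFun φ := ⟨fun x => φ.1 ⟨x.1, hVU x.2⟩, fun x => by
    obtain ⟨p, q, hq, h1⟩ := φ.2 ⟨x.1, hVU x.2⟩
    exact ⟨p, q, hq, fun y hy => h1 ⟨y.1, hVU y.2⟩ hy⟩⟩
  map_one' := rfl
  map_mul' _ _ := rfl
  map_zero' := rfl
  map_add' _ _ := rfl
  commutes' _ := rfl

/-- The left action of `t ∈ H` on regular functions, `(t · φ)(v) = φ(v · t)`; it sends functions
on `W` to functions on `{v | v · t ∈ W}`. -/
def Reg.act (t : H) (W : Opens BaseAffine) : Reg W →ₐ[ℂ] Reg (translate t W) where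
  toFun φ := ⟨fun x => φ.1 ⟨rightAct x.1 t, x.2⟩, fun x => by
    obtain ⟨p, q, hq, h1⟩ := φ.2 ⟨rightAct x.1 t, x.2⟩
    refine ⟨MvPolynomial.aeval (fun i => MvPolynomial.C ((t : G) 0 0) * MvPolynomial.X i) p,
      MvPolynomial.aeval (fun i => MvPolynomial.C ((t : G) 0 0) * MvPolynomial.X i) q,
      ?_, fun y hy => ?_⟩
    · rw [← eval_rightAct]; exact hq
    · rw [← eval_rightAct] at hy ⊢
      rw [← eval_rightAct]
      exact h1 ⟨rightAct y.1 t, y.2⟩ hy⟩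
  map_one' := rfl
  map_mul' _ _ := rfl
  map_zero' := rfl
  map_add' _ _ := rfl
  commutes' _ := rfl

/-- Grothendieck's differential operators of order at most `n` on a commutative `ℂ`-algebra `A`:
the order is at most `0` if all commutators with multiplications by elements of `A` vanish, and
at most `n + 1` if all these commutators have order at most `n`. -/
def IsDiffOp {A : Type} [CommRing A] [Algebra ℂ A] : ℕ → Module.End ℂ A → Prop
  | 0, θ => ∀ a : A, θ * LinearMap.mulLeft ℂ a - LinearMap.mulLeft ℂ a * θ = 0
  | n + 1, θ => ∀ a : A, IsDiffOp n (θ * LinearMap.mulLeft ℂ a - LinearMap.mulLeft ℂ a * θ)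

section

variable {A : Type} [CommRing A] [Algebra ℂ A]

theorem IsDiffOp.zero (n : ℕ) : IsDiffOp n (0 : Module.End ℂ A) := by
  induction n with
  | zero => intro a; simp
  | succ n ih => intro a; simpa using ih

theorem IsDiffOp.succ {n : ℕ} : ∀ {θ : Module.End ℂ A}, IsDiffOp n θ → IsDiffOp (n + 1) θ := by
  induction n with
  | zero => intro θ hθ a; rw [hθ a]; exact IsDiffOp.zero 0
  | succ n ih => intro θ hθ a; exact ih (hθ a)

theorem IsDiffOp.mono {m n : ℕ} (hmn : m ≤ n) {θ : Module.End ℂ A} (hθ : IsDiffOp m θ) :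
    IsDiffOp n θ := by
  induction hmn with
  | refl => exact hθ
  | step _ ih => exact ih.succ

theorem IsDiffOp.add {n : ℕ} : ∀ {θ η : Module.End ℂ A}, IsDiffOp n θ → IsDiffOp n η →
    IsDiffOp n (θ + η) := by
  induction n with
  | zero =>
    intro θ η hθ hη a
    have := congrArg₂ (· + ·) (hθ a) (hη a)
    simp only [add_zero] at this
    rw [← this]; noncomm_ring
  | succ n ih =>
    intro θ η hθ hη a
    have := ih (hθ a) (hη a)
    convert this using 1
    noncomm_ring

theorem IsDiffOp.mul (k : ℕ) : ∀ {m n : ℕ} {θ η : Module.End ℂ A}, m + n = k →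
    IsDiffOp m θ → IsDiffOp n η → IsDiffOp k (θ * η) := by
  have key : ∀ (θ η : Module.End ℂ A) (a : A),
      θ * η * LinearMap.mulLeft ℂ a - LinearMap.mulLeft ℂ a * (θ * η) =
      θ * (η * LinearMap.mulLeft ℂ a - LinearMap.mulLeft ℂ a * η) +
        (θ * LinearMap.mulLeft ℂ a - LinearMap.mulLeft ℂ a * θ) * η := by
    intro θ η a; simp only [mul_sub, sub_mul, mul_assoc]; abel
  induction k with
  | zero =>
    intro m n θ η hk hθ hη a
    obtain ⟨rfl, rfl⟩ : m = 0 ∧ n = 0 := by omega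
    rw [key, hθ a, hη a]; simp
  | succ k ih =>
    intro m n θ η hk hθ hη a
    rw [key]
    refine IsDiffOp.add ?_ ?_
    · rcases n with _ | n
      · rw [hη a, mul_zero]; exact IsDiffOp.zero k
      · exact ih (by omega) hθ (hη a)
    · rcases m with _ | m
      · rw [hθ a, zero_mul]; exact IsDiffOp.zero k
      · exact ih (by omega) (hθ a) hη

theorem IsDiffOp.algebraMap (c : ℂ) : IsDiffOp 0 (algebraMap ℂ (Module.End ℂ A) c) := by
  intro a; rw [Algebra.commutes, sub_self]

end

/-- The algebra `𝒟_X̃(U)` of sections over `U` of the sheaf of differential operators on `X̃`: the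
`ℂ`-linear endomorphisms `θ` of the sheaf `𝒪|_U`, i.e. families `θ_W : 𝒪(W) → 𝒪(W)` (`W ⊆ U` open)
commuting with restriction, which are differential operators of some finite order.  (Open subsets
of `X̃` are quasi-compact, so an operator which is locally of finite order has finite order.) -/
def diffSubalgebra (U : Opens BaseAffine) :
    Subalgebra ℂ (∀ W : {W : Opens BaseAffine // W ≤ U}, Module.End ℂ (Reg W.1)) where
  carrier := {θ | (∀ (W W' : {W : Opens BaseAffine // W ≤ U}) (hW : W'.1 ≤ W.1) (φ : Reg W.1),
      θ W' (Reg.res hW φ) = Reg.res hW (θ W φ)) ∧ ∃ n, ∀ W, IsDiffOp n (θ W)}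
  mul_mem' := by
    rintro θ η ⟨h1, m, hm⟩ ⟨h2, n, hn⟩
    exact ⟨fun W W' hW φ => by simp [h1 W W' hW, h2 W W' hW],
      m + n, fun W => IsDiffOp.mul _ rfl (hm W) (hn W)⟩
  add_mem' := by
    rintro θ η ⟨h1, m, hm⟩ ⟨h2, n, hn⟩
    exact ⟨fun W W' hW φ => by simp [h1 W W' hW, h2 W W' hW],
      max m n, fun W => ((hm W).mono (le_max_left _ _)).add ((hn W).mono (le_max_right _ _))⟩
  algebraMap_mem' := by
    intro c
    exact ⟨fun W W' hW φ => by simp [Module.algebraMap_end_apply],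
      0, fun W => IsDiffOp.algebraMap c⟩

/-- `𝒟_X̃(U)` as a type. -/
def Diff (U : Opens BaseAffine) : Type := diffSubalgebra U

instance (U : Opens BaseAffine) : Ring (Diff U) := inferInstanceAs (Ring (diffSubalgebra U))

instance (U : Opens BaseAffine) : Algebra ℂ (Diff U) :=
  inferInstanceAs (Algebra ℂ (diffSubalgebra U))

theorem translate_le {t : H} {U : Opens Flag} {W : Opens BaseAffine} (hW : W ≤ πInv U) :
    translate t W ≤ πInv U := by
  intro v hv
  have h1 : π (rightAct v t) ∈ U := hW hv
  rw [π_rightAct] at h1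
  exact h1

/-- The sheaf `𝒟̃ = [π_* 𝒟_X̃]^H` on `X`: its sections over `U` are the `θ ∈ 𝒟_X̃(π⁻¹ U)` which are
invariant under `H`.  The action of `H` on `𝒟_X̃` is given by `(t · θ)(t · φ) = t · θ(φ)`, so `θ` is
invariant if and only if `θ(t · φ) = t · θ(φ)` for all `t ∈ H` and all local sections `φ`. -/
def dTildeSubalgebra (U : Opens Flag) : Subalgebra ℂ (Diff (πInv U)) where
  carrier := {θ | ∀ (t : H) (W : {W : Opens BaseAffine // W ≤ πInv U}) (φ : Reg W.1),
    θ.1 ⟨translate t W.1, translate_le W.2⟩ (Reg.act t W.1 φ) = Reg.act t W.1 (θ.1 W φ)}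
  mul_mem' := by
    intro θ η hθ hη t W φ
    exact (congrArg (θ.1 ⟨translate t W.1, translate_le W.2⟩) (hη t W φ)).trans
      (hθ t W (η.1 W φ))
  add_mem' := by
    intro θ η hθ hη t W φ
    exact (congrArg₂ (· + ·) (hθ t W φ) (hη t W φ)).trans (map_add (Reg.act t W.1) _ _).symm
  algebraMap_mem' := by
    intro c t W φ
    change algebraMap ℂ (Module.End ℂ _) c _ = Reg.act t W.1 (algebraMap ℂ (Module.End ℂ _) c _)
    simp [Module.algebraMap_end_apply]

/-- `𝒟̃(U)` as a type. -/
def DTilde (U : Opens Flag) : Type := dTildeSubalgebra U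

instance (U : Opens Flag) : Ring (DTilde U) := inferInstanceAs (Ring (dTildeSubalgebra U))

instance (U : Opens Flag) : Algebra ℂ (DTilde U) :=
  inferInstanceAs (Algebra ℂ (dTildeSubalgebra U))

/-- The global sections `Γ(X, 𝒟̃)`. -/
abbrev GlobalDTilde : Type := DTilde ⊤

/-- The value `(θ φ)(v)` for `θ ∈ Γ(X, 𝒟̃)`, `φ ∈ 𝒪(W)` and `v ∈ W`, with `W ⊆ X̃` open. -/
def GlobalDTilde.app (θ : GlobalDTilde) {W : Opens BaseAffine} (φ : Reg W) (v : W) : ℂ :=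
  (θ.1.1 ⟨W, fun _ _ => trivial⟩ φ).1 v

/-! ### Differentiating the actions -/

/-- Extension by zero of a regular function on `W ⊆ X̃ ⊆ ℂ²` to all of `ℂ²`. -/
def extend {W : Opens BaseAffine} (φ : Reg W) (w : Fin 2 → ℂ) : ℂ :=
  open Classical in
  if hw : ∃ h0 : w ≠ 0, (⟨w, h0⟩ : BaseAffine) ∈ W then φ.1 ⟨⟨w, hw.1⟩, hw.2⟩ else 0

open NormedSpace in
theorem det_exp (x : 𝔤) : (exp x.1).det = 1 := by
  let _ : SeminormedRing (Matrix (Fin 2) (Fin 2) ℂ) := Matrix.linftyOpSemiNormedRing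
  let _ : NormedRing (Matrix (Fin 2) (Fin 2) ℂ) := Matrix.linftyOpNormedRing
  let _ : NormedAlgebra ℂ (Matrix (Fin 2) (Fin 2) ℂ) := Matrix.linftyOpNormedAlgebra
  have hx : x.1 1 1 = - x.1 0 0 := by
    have := x.2
    simp [LieAlgebra.SpecialLinear.sl, Matrix.trace] at this
    linear_combination this
  have hd : ∀ (t : ℂ) (i j : Fin 2), HasDerivAt (fun t : ℂ => exp (t • x.1) i j)
      ((exp (t • x.1) * x.1) i j) t := fun t i j =>
    (((Matrix.entryLinearMap ℂ ℂ i j).toContinuousLinearMap).hasFDerivAt.comp_hasDerivAt t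
      (hasDerivAt_exp_smul_const x.1 t) :)
  have hdet : ∀ t : ℂ, HasDerivAt (fun t : ℂ => (exp (t • x.1)).det) 0 t := by
    intro t
    simp only [Matrix.det_fin_two]
    have key := ((hd t 0 0).mul (hd t 1 1)).sub ((hd t 0 1).mul (hd t 1 0))
    refine key.congr_deriv ?_
    simp only [Matrix.mul_apply, Fin.sum_univ_two, hx]
    ring
  have := is_const_of_deriv_eq_zero (fun t => (hdet t).differentiableAt)
    (fun t => (hdet t).deriv) 1 0
  simpa using this

/-- The exponential map `𝔤 → G`. -/
def expG (x : 𝔤) : G := ⟨NormedSpace.exp x.1, det_exp x⟩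

theorem expG_mem (y : 𝔥) : expG y ∈ H := by
  obtain ⟨a, ha⟩ := Submodule.mem_span_singleton.1 y.2
  have hy : (y : 𝔤).1 = Matrix.diagonal ![a, -a] := by
    rw [← ha]
    ext i j
    fin_cases i <;> fin_cases j <;> simp [h]
  constructor <;> simp [expG, hy, Matrix.exp_diagonal]

/-- The exponential map `𝔥 → H`. -/
def expH (y : 𝔥) : H := ⟨expG y, expG_mem y⟩

/-- `θ` is the vector field `L_x` obtained by differentiating the left action of `G`:
`L_x φ(v) = d/dt|_{t=0} φ(exp(tx)⁻¹ v)`. -/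
def IsL (x : 𝔤) (θ : GlobalDTilde) : Prop :=
  ∀ (W : Opens BaseAffine) (φ : Reg W) (v : W),
    HasDerivAt (fun t : ℂ => extend φ (leftAct (expG (t • x))⁻¹ v).1) (θ.app φ v) 0

/-- `θ` is the vector field `R_y` obtained by differentiating the right action of `H`:
`R_y φ(v) = d/dt|_{t=0} φ(v exp(ty))`. -/
def IsR (y : 𝔥) (θ : GlobalDTilde) : Prop :=
  ∀ (W : Opens BaseAffine) (φ : Reg W) (v : W),
    HasDerivAt (fun t : ℂ => extend φ (rightAct v (expH (t • y))).1) (θ.app φ v) 0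

/-- `α : Ũ → Γ(X, 𝒟̃)` is the algebra homomorphism `g ⊗ g' ↦ L_g R_{g'}`. -/
def IsAlpha (α : Utilde →ₐ[ℂ] GlobalDTilde) : Prop :=
  (∀ x : 𝔤, IsL x (α (ι𝔤 x ⊗ₜ 1))) ∧ ∀ y : 𝔥, IsR y (α (1 ⊗ₜ ι𝔥 y))

/-- `θ` is the differential operator `x_i ∂_j`: `(θ φ)(v) = v_i · ∂φ/∂x_j(v)`. -/
def IsCoordOp (i j : Fin 2) (θ : GlobalDTilde) : Prop :=
  ∀ (W : Opens BaseAffine) (φ : Reg W) (v : W), ∃ d : ℂ,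
    HasDerivAt (fun s : ℂ => extend φ (Function.update v.1.1 j s)) d (v.1.1 j) ∧
      θ.app φ v = v.1.1 i * d

end SL2Loc

end

/-!
Everything is reduced to operators on the polynomial ring `ℂ[x₁, x₂]`, which is the algebra of
global functions on `X̃ = ℂ² ∖ {0}` (`ofPoly_top_surjective`).

* A section of `𝒟̃` over `X` is determined by its action on global functions, because a differential
  operator which vanishes on polynomials vanishes on fractions of polynomials
  (`polyRep_injective`).  The invariance under `H` says that this action preserves degrees.
* A differential operator on `ℂ[x₁, x₂]` which preserves degrees is a sum of operators `p ∂^β` with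
  `p` homogeneous of degree `|β|`, and these are noncommutative polynomials in the `x_i ∂_j`
  (`mem_coordAlg`, `weylOp_mem`).  So the `x_i ∂_j` generate `Γ(X, 𝒟̃)` (`adjoin_coordOp`), and the
  Euler field `R_h` is central (`euler_comm`).
* The homomorphism `u ⊗ c ↦ L_u R_c` is well defined if `L_z = R_{γ_HC(z)}` for central `z`
  (`homL_center`).  The polynomials of degree `d` are generated under `L_f` by the vector `x₂^d`,
  which has weight `d` and is killed by `L_e`.  A central element therefore acts on them by the
  value at `d` of its Harish-Chandra projection, and `R_h` acts on them by `d`.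
* Surjectivity holds because the `x_i ∂_j` are combinations of `L_e`, `L_f`, `L_h` and `R_h`.  For
  injectivity, put `P = (H - h) / 2` and `Q = (H + h) / 2` in `Ũ`, where `H = 1 ⊗ h`.  The Casimir
  element gives `f e = P + P Q` and `e f = Q + P Q`, so that every element of `Ũ` is a sum of
  terms `q(P, Q) f^a` and `q(P, Q) e^a` (`normalForm_range`).  Since `P` and `Q` act as `x₁∂₁` and
  `x₂∂₂`, a vanishing operator forces each polynomial `q` to vanish at all pairs of large natural
  numbers, hence to be zero (`alpha_normalForm_injective`).  In particular no
  Poincaré–Birkhoff–Witt theorem is needed.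
-/

noncomputable section

namespace SL2Loc

attribute [local instance 100] LieRing.ofAssociativeRing

open TopologicalSpace Topology TensorProduct

/-! ### Regular functions as differentiable functions -/

/-- The polynomial algebra `ℂ[x₁, x₂]`, which is the algebra of global functions on `X̃`. -/
abbrev Poly : Type := MvPolynomial (Fin 2) ℂ

theorem Reg.ext {W : Opens BaseAffine} {φ ψ : Reg W} (h : ∀ v : W, φ.1 v = ψ.1 v) : φ = ψ :=
  Subtype.ext (funext h)

theorem Reg.add_val {W : Opens BaseAffine} (φ ψ : Reg W) (v : W) :
    (φ + ψ).1 v = φ.1 v + ψ.1 v := rfl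

theorem Reg.mul_val {W : Opens BaseAffine} (φ ψ : Reg W) (v : W) :
    (φ * ψ).1 v = φ.1 v * ψ.1 v := rfl

theorem Reg.smul_val {W : Opens BaseAffine} (c : ℂ) (φ : Reg W) (v : W) :
    (c • φ).1 v = c * φ.1 v := rfl

theorem Reg.res_val {W W' : Opens BaseAffine} (hW : W' ≤ W) (φ : Reg W) (v : W') :
    (Reg.res hW φ).1 v = φ.1 ⟨v.1, hW v.2⟩ := rfl

theorem Reg.act_val (t : H) {W : Opens BaseAffine} (φ : Reg W) (v : translate t W) :
    (Reg.act t W φ).1 v = φ.1 ⟨rightAct v.1 t, v.2⟩ := rfl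

/-- The restriction of a polynomial function to an open subset of `X̃`. -/
def ofPoly (W : Opens BaseAffine) : Poly →ₐ[ℂ] Reg W where
  toFun p := ⟨fun v => MvPolynomial.eval v.1.1 p, fun _ => ⟨p, 1, by simp, fun _ _ => by simp⟩⟩
  map_one' := Subtype.ext (funext fun _ => map_one _)
  map_mul' _ _ := Subtype.ext (funext fun _ => map_mul _ _ _)
  map_zero' := Subtype.ext (funext fun _ => map_zero _)
  map_add' _ _ := Subtype.ext (funext fun _ => map_add _ _ _)
  commutes' c := Subtype.ext (funext fun _ => MvPolynomial.eval_C c)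

theorem ofPoly_val (W : Opens BaseAffine) (p : Poly) (v : W) :
    (ofPoly W p).1 v = MvPolynomial.eval v.1.1 p := rfl

/-- Zariski open subsets of `ℂ² ∖ {0}` are open in the classical topology of `ℂ²`. -/
theorem isOpen_classical (W : Opens BaseAffine) :
    IsOpen {w : Fin 2 → ℂ | ∃ h0 : w ≠ 0, (⟨w, h0⟩ : BaseAffine) ∈ W} := by
  let i : {w : Fin 2 → ℂ // w ≠ 0} → BaseAffine := fun w => w
  have hi : Continuous i := by
    refine continuous_generateFrom_iff.2 ?_
    rintro _ ⟨p, rfl⟩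
    have hc : Continuous fun w : {w : Fin 2 → ℂ // w ≠ 0} => MvPolynomial.eval w.1 p :=
      (MvPolynomial.continuous_eval p).comp continuous_subtype_val
    exact isOpen_ne.preimage hc
  have h2 : IsOpen (i ⁻¹' W) := W.2.preimage hi
  have h3 : IsOpen {w : Fin 2 → ℂ | w ≠ 0} := isOpen_ne
  have h4 := h3.isOpenEmbedding_subtypeVal.isOpenMap _ h2
  convert h4 using 1
  ext w
  constructor
  · rintro ⟨h0, hw⟩; exact ⟨⟨w, h0⟩, hw, rfl⟩
  · rintro ⟨⟨w', h0⟩, hw, rfl⟩; exact ⟨h0, hw⟩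

theorem extend_apply {W : Opens BaseAffine} (φ : Reg W) (v : W) : extend φ v.1.1 = φ.1 v := by
  unfold extend
  rw [dif_pos ⟨v.1.2, v.2⟩]
  rfl

theorem eventually_mem {W : Opens BaseAffine} (v : W) :
    ∀ᶠ w in 𝓝 v.1.1, ∃ h0 : w ≠ 0, (⟨w, h0⟩ : BaseAffine) ∈ W :=
  (isOpen_classical W).mem_nhds ⟨v.1.2, v.2⟩

/-- Identities between regular functions propagate to their extensions by zero near a point. -/
theorem extend_eventuallyEq {W : Opens BaseAffine} (φ : Reg W) (F : (Fin 2 → ℂ) → ℂ) (v : W)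
    (hF : ∀ᶠ w in 𝓝 v.1.1, ∀ u : W, u.1.1 = w → φ.1 u = F w) : extend φ =ᶠ[𝓝 v.1.1] F := by
  filter_upwards [hF, eventually_mem v] with w hw ⟨h0, hm⟩
  exact (extend_apply φ ⟨⟨w, h0⟩, hm⟩).trans (hw ⟨⟨w, h0⟩, hm⟩ rfl)

theorem hasFDerivAt_eval (p : Poly) (v : Fin 2 → ℂ) :
    HasFDerivAt (fun w => MvPolynomial.eval w p)
      (∑ j, MvPolynomial.eval v (MvPolynomial.pderiv j p) •
        (ContinuousLinearMap.proj j : (Fin 2 → ℂ) →L[ℂ] ℂ)) v := by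
  induction p using MvPolynomial.induction_on with
  | C a =>
    simp only [MvPolynomial.eval_C]
    refine (hasFDerivAt_const (𝕜 := ℂ) a v).congr_fderiv ?_
    ext w
    simp
  | add p q hp hq =>
    simp only [map_add]
    refine (hp.fun_add hq).congr_fderiv ?_
    ext w
    simp
    ring
  | mul_X p i hp =>
    simp only [map_mul, MvPolynomial.eval_X]
    have hi := (ContinuousLinearMap.proj i : (Fin 2 → ℂ) →L[ℂ] ℂ).hasFDerivAt (x := v)
    refine (hp.fun_mul hi).congr_fderiv ?_
    ext w
    fin_cases i <;> simp [MvPolynomial.pderiv_X, Pi.single_apply] <;> ring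

/-- A fraction of polynomials representing `φ` on the set where its denominator does not vanish
represents the extension of `φ` near every point of that set. -/
theorem extend_eventuallyEq_div {W : Opens BaseAffine} {φ : Reg W} {p q : Poly}
    (h1 : ∀ y : W, MvPolynomial.eval y.1.1 q ≠ 0 →
      φ.1 y = MvPolynomial.eval y.1.1 p / MvPolynomial.eval y.1.1 q)
    (v : W) (hq : MvPolynomial.eval v.1.1 q ≠ 0) :
    extend φ =ᶠ[𝓝 v.1.1] fun w => MvPolynomial.eval w p / MvPolynomial.eval w q := by
  refine extend_eventuallyEq φ _ v ?_
  filter_upwards [(MvPolynomial.continuous_eval q).continuousAt.eventually_ne hq] with w hw u hu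
  subst hu
  exact h1 u hw

/-- The quotient rule for a local representation of `φ` as a fraction. -/
theorem hasFDerivAt_extend_div {W : Opens BaseAffine} {φ : Reg W} {p q : Poly}
    (h1 : ∀ y : W, MvPolynomial.eval y.1.1 q ≠ 0 →
      φ.1 y = MvPolynomial.eval y.1.1 p / MvPolynomial.eval y.1.1 q)
    (v : W) (hq : MvPolynomial.eval v.1.1 q ≠ 0) :
    HasFDerivAt (extend φ)
      (∑ j, (MvPolynomial.eval v.1.1
          (MvPolynomial.pderiv j p * q - p * MvPolynomial.pderiv j q) /
          MvPolynomial.eval v.1.1 (q * q)) •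
        (ContinuousLinearMap.proj j : (Fin 2 → ℂ) →L[ℂ] ℂ)) v.1.1 := by
  refine HasFDerivAt.congr_of_eventuallyEq ?_ (extend_eventuallyEq_div h1 v hq)
  simp only [div_eq_mul_inv]
  refine ((hasFDerivAt_eval p v.1.1).fun_mul
    ((hasDerivAt_inv hq).comp_hasFDerivAt v.1.1 (hasFDerivAt_eval q v.1.1))).congr_fderiv ?_
  ext w
  simp
  field_simp
  ring

theorem differentiableAt_extend {W : Opens BaseAffine} (φ : Reg W) (v : W) :
    DifferentiableAt ℂ (extend φ) v.1.1 := by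
  obtain ⟨p, q, hq, h1⟩ := φ.2 v
  exact (hasFDerivAt_extend_div h1 v hq).differentiableAt

theorem extend_add {W : Opens BaseAffine} (φ ψ : Reg W) :
    extend (φ + ψ) = extend φ + extend ψ := by
  funext w
  simp only [extend, Pi.add_apply]
  split_ifs
  · rfl
  · simp

theorem extend_mul {W : Opens BaseAffine} (φ ψ : Reg W) :
    extend (φ * ψ) = extend φ * extend ψ := by
  funext w
  simp only [extend, Pi.mul_apply]
  split_ifs
  · rfl
  · simp

theorem extend_smul {W : Opens BaseAffine} (c : ℂ) (φ : Reg W) :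
    extend (c • φ) = c • extend φ := by
  funext w
  simp only [extend, Pi.smul_apply]
  split_ifs
  · rfl
  · simp

theorem extend_act (t : H) {W : Opens BaseAffine} (φ : Reg W) (w : Fin 2 → ℂ) :
    extend (Reg.act t W φ) w = extend φ ((t : G) 0 0 • w) := by
  by_cases hw : ∃ h0 : w ≠ 0, (⟨w, h0⟩ : BaseAffine) ∈ translate t W
  · obtain ⟨h0, hm⟩ := hw
    exact (extend_apply (Reg.act t W φ) ⟨⟨w, h0⟩, hm⟩).trans
      (extend_apply φ ⟨rightAct ⟨w, h0⟩ t, hm⟩).symm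
  · have hw' : ¬ ∃ h0 : (t : G) 0 0 • w ≠ 0, (⟨(t : G) 0 0 • w, h0⟩ : BaseAffine) ∈ W := by
      rintro ⟨h0, hm⟩
      exact hw ⟨right_ne_zero_of_smul h0, hm⟩
    unfold extend
    rw [dif_neg hw, dif_neg hw']

/-- The partial derivative `∂_j φ` of a regular function. -/
def partialFun (j : Fin 2) {W : Opens BaseAffine} (φ : Reg W) : Reg W :=
  ⟨fun v => fderiv ℂ (extend φ) v.1.1 (Pi.single j 1), fun v => by
    obtain ⟨p, q, hq, h1⟩ := φ.2 v
    refine ⟨MvPolynomial.pderiv j p * q - p * MvPolynomial.pderiv j q, q * q, by simp [hq],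
      fun y hy => ?_⟩
    rw [map_mul] at hy
    change fderiv ℂ (extend φ) y.1.1 (Pi.single j 1) = _
    rw [(hasFDerivAt_extend_div h1 y (left_ne_zero_of_mul hy)).fderiv]
    fin_cases j <;> simp⟩

theorem partialFun_val (j : Fin 2) {W : Opens BaseAffine} (φ : Reg W) (v : W) :
    (partialFun j φ).1 v = fderiv ℂ (extend φ) v.1.1 (Pi.single j 1) := rfl

/-- The derivation `∂_j` of `𝒪(W)`. -/
def partialD (j : Fin 2) (W : Opens BaseAffine) : Derivation ℂ (Reg W) (Reg W) :=
  Derivation.mk'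
    { toFun := partialFun j
      map_add' := fun φ ψ => Reg.ext fun v => by
        rw [Reg.add_val, partialFun_val, extend_add,
          fderiv_add (differentiableAt_extend φ v) (differentiableAt_extend ψ v)]
        rfl
      map_smul' := fun c φ => Reg.ext fun v => by
        rw [RingHom.id_apply, Reg.smul_val, partialFun_val, extend_smul,
          fderiv_const_smul (differentiableAt_extend φ v)]
        rfl }
    fun φ ψ => Reg.ext fun v => by
      change (partialFun j (φ * ψ)).1 v = (φ * partialFun j ψ + ψ * partialFun j φ).1 v
      rw [partialFun_val, extend_mul,
        fderiv_mul (differentiableAt_extend φ v) (differentiableAt_extend ψ v)]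
      simp [Reg.add_val, Reg.mul_val, partialFun_val, extend_apply]

theorem partialD_val (j : Fin 2) {W : Opens BaseAffine} (φ : Reg W) (v : W) :
    (partialD j W φ).1 v = fderiv ℂ (extend φ) v.1.1 (Pi.single j 1) := rfl

/-- The directional derivatives of a regular function in terms of its partial derivatives. -/
theorem fderiv_extend_apply {W : Opens BaseAffine} (φ : Reg W) (v : W) (w : Fin 2 → ℂ) :
    fderiv ℂ (extend φ) v.1.1 w = w 0 * (partialD 0 W φ).1 v + w 1 * (partialD 1 W φ).1 v := by
  have hw : w = w 0 • Pi.single 0 1 + w 1 • Pi.single 1 1 := by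
    ext i; fin_cases i <;> simp
  conv_lhs => rw [hw]
  rw [map_add, map_smul, map_smul]
  rfl

theorem partialD_res (j : Fin 2) {W W' : Opens BaseAffine} (hW : W' ≤ W) (φ : Reg W) :
    partialD j W' (Reg.res hW φ) = Reg.res hW (partialD j W φ) := by
  refine Reg.ext fun v => ?_
  have h1 : extend (Reg.res hW φ) =ᶠ[𝓝 v.1.1] extend φ := by
    refine extend_eventuallyEq _ _ v (Filter.Eventually.of_forall ?_)
    rintro _ u rfl
    exact (extend_apply φ ⟨u.1, hW u.2⟩).symm
  rw [Reg.res_val, partialD_val, partialD_val, h1.fderiv_eq]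

theorem partialD_act (j : Fin 2) (t : H) {W : Opens BaseAffine} (φ : Reg W) :
    partialD j (translate t W) (Reg.act t W φ) =
      ((t : G) 0 0) • Reg.act t W (partialD j W φ) := by
  refine Reg.ext fun v => ?_
  have h1 : extend (Reg.act t W φ) = fun w => extend φ ((t : G) 0 0 • w) :=
    funext (extend_act t φ)
  have h2 := differentiableAt_extend φ ⟨rightAct v.1 t, v.2⟩
  rw [Reg.smul_val, Reg.act_val, partialD_val, partialD_val, h1]
  have h3 : HasFDerivAt (fun w : Fin 2 → ℂ => (t : G) 0 0 • w)
      ((t : G) 0 0 • ContinuousLinearMap.id ℂ (Fin 2 → ℂ)) v.1.1 :=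
    (hasFDerivAt_id _).fun_const_smul _
  have h4 : HasFDerivAt (fun w : Fin 2 → ℂ => extend φ ((t : G) 0 0 • w)) _ v.1.1 :=
    HasFDerivAt.comp v.1.1 (f := fun w : Fin 2 → ℂ => (t : G) 0 0 • w) h2.hasFDerivAt h3
  rw [h4.fderiv]
  simp only [ContinuousLinearMap.comp_apply, smul_apply,
    ContinuousLinearMap.id_apply, map_smul, smul_eq_mul]

theorem partialD_ofPoly (j : Fin 2) (W : Opens BaseAffine) (p : Poly) :
    partialD j W (ofPoly W p) = ofPoly W (MvPolynomial.pderiv j p) := by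
  refine Reg.ext fun v => ?_
  have h1 : ∀ y : W, MvPolynomial.eval y.1.1 (1 : Poly) ≠ 0 → (ofPoly W p).1 y =
      MvPolynomial.eval y.1.1 p / MvPolynomial.eval y.1.1 (1 : Poly) := by
    intro y _; simp [ofPoly_val]
  rw [partialD_val, (hasFDerivAt_extend_div h1 v (by simp)).fderiv]
  fin_cases j <;> simp [ofPoly_val]

/-! ### The operators `x_i ∂_j` -/

/-- A derivation is a differential operator of order at most one. -/
theorem isDiffOp_derivation {A : Type} [CommRing A] [Algebra ℂ A] (D : Derivation ℂ A A) :
    IsDiffOp 1 (D : A →ₗ[ℂ] A) := by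
  intro a b
  ext c
  simp
  ring

/-- Equality of elements of `Γ(X, 𝒟̃)` may be checked on values. -/
theorem GlobalDTilde.ext {θ η : GlobalDTilde}
    (hθ : ∀ (W : Opens BaseAffine) (φ : Reg W) (v : W), θ.app φ v = η.app φ v) : θ = η := by
  refine Subtype.ext (Subtype.ext (funext fun W => LinearMap.ext fun φ => ?_))
  obtain ⟨W, hW⟩ := W
  exact Reg.ext fun v => hθ W φ v

/-- The operator `x_i ∂_j` as a global section of `𝒟̃`. -/
def coordOp (i j : Fin 2) : GlobalDTilde :=
  ⟨⟨fun W => ((ofPoly W.1 (MvPolynomial.X i) • partialD j W.1 : Derivation ℂ (Reg W.1) (Reg W.1)) :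
      Reg W.1 →ₗ[ℂ] Reg W.1),
    ⟨fun W W' hW φ => by
      change ofPoly W'.1 _ * partialD j W'.1 (Reg.res hW φ) =
        Reg.res hW (ofPoly W.1 _ * partialD j W.1 φ)
      rw [partialD_res, map_mul]
      rfl,
    1, fun W => isDiffOp_derivation _⟩⟩,
  fun t W φ => by
    change ofPoly _ _ * partialD j (translate t W.1) (Reg.act t W.1 φ) =
      Reg.act t W.1 (ofPoly W.1 _ * partialD j W.1 φ)
    rw [partialD_act, map_mul]
    refine Reg.ext fun v => ?_
    simp [Reg.mul_val, Reg.smul_val, Reg.act_val, ofPoly_val, rightAct]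
    ring⟩

theorem coordOp_app (i j : Fin 2) {W : Opens BaseAffine} (φ : Reg W) (v : W) :
    (coordOp i j).app φ v = v.1.1 i * (partialD j W φ).1 v := by
  change MvPolynomial.eval v.1.1 (MvPolynomial.X i) * _ = _
  rw [MvPolynomial.eval_X]
  rfl

theorem isCoordOp_coordOp (i j : Fin 2) : IsCoordOp i j (coordOp i j) := by
  intro W φ v
  refine ⟨(partialD j W φ).1 v, ?_, coordOp_app i j φ v⟩
  have h1 := (differentiableAt_extend φ v).hasFDerivAt
  have h2 := hasDerivAt_update v.1.1 j (v.1.1 j)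
  rw [← Function.update_eq_self j v.1.1] at h1
  have := HasFDerivAt.comp_hasDerivAt (v.1.1 j) (by simpa using h1) h2
  exact this

/-! ### Global functions on `ℂ² ∖ {0}` -/

/-- The point `v` of `ℂ² ∖ {0}`, as a point of the largest open set. -/
def topPt (v : Fin 2 → ℂ) (hv : v ≠ 0) : (⊤ : Opens BaseAffine) := ⟨⟨v, hv⟩, trivial⟩

theorem ofPoly_top_injective : Function.Injective (ofPoly ⊤) := by
  rw [injective_iff_map_eq_zero]
  intro p hp
  have h1 : MvPolynomial.X 0 * p = 0 := by
    refine MvPolynomial.funext fun v => ?_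
    by_cases hv : v = 0
    · simp [hv]
    · have h2 : (ofPoly ⊤ p).1 (topPt v hv) = 0 := by rw [hp]; rfl
      have h3 : MvPolynomial.eval v p = 0 := h2
      simp [h3]
  exact (mul_eq_zero.1 h1).resolve_left (MvPolynomial.X_ne_zero 0)

/-- The ideal of denominators of a global function `φ`: the polynomials `q` for which `q φ` is a
polynomial. -/
def denomIdeal (φ : Reg ⊤) : Ideal Poly where
  carrier := {q | ∃ p, ofPoly ⊤ q * φ = ofPoly ⊤ p}
  zero_mem' := ⟨0, by simp⟩
  add_mem' := by
    rintro a b ⟨p, hp⟩ ⟨q, hq⟩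
    exact ⟨p + q, by rw [map_add, map_add, add_mul, hp, hq]⟩
  smul_mem' := by
    rintro c a ⟨p, hp⟩
    exact ⟨c * p, by rw [smul_eq_mul, map_mul, map_mul, mul_assoc, hp]⟩

/-- By the Nullstellensatz, the ideal of denominators contains a power of each variable, because
its zero locus is contained in `{0}`. -/
theorem exists_X_pow_mem_denomIdeal (φ : Reg ⊤) (i : Fin 2) :
    ∃ n : ℕ, (MvPolynomial.X i ^ n : Poly) ∈ denomIdeal φ := by
  have h1 : (MvPolynomial.X i : Poly) ∈
      MvPolynomial.vanishingIdeal ℂ (MvPolynomial.zeroLocus ℂ (denomIdeal φ)) := by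
    rw [MvPolynomial.mem_vanishingIdeal_iff]
    intro x hx
    suffices x = 0 by simp [this]
    by_contra h0
    obtain ⟨p, q, hq, h2⟩ := φ.2 (topPt x h0)
    -- `q φ = p` is only known where `q ≠ 0`, but `q² φ = q p` holds everywhere
    have h3 : q * q ∈ denomIdeal φ := by
      refine ⟨q * p, Reg.ext fun y => ?_⟩
      rw [Reg.mul_val, ofPoly_val, ofPoly_val, map_mul, map_mul]
      by_cases hy : MvPolynomial.eval y.1.1 q = 0
      · simp [hy]
      · have h4 : φ.1 y = _ := h2 y hy
        rw [h4]
        field_simp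
    have h5 := (MvPolynomial.mem_zeroLocus_iff).1 hx _ h3
    rw [map_mul] at h5
    exact (mul_self_ne_zero.2 hq) h5
  rw [MvPolynomial.vanishingIdeal_zeroLocus_eq_radical] at h1
  exact h1

/-- Every global function on `ℂ² ∖ {0}` is a polynomial. -/
theorem ofPoly_top_surjective : Function.Surjective (ofPoly ⊤) := by
  intro φ
  obtain ⟨n, P, hP⟩ := exists_X_pow_mem_denomIdeal φ 0
  obtain ⟨m, Q, hQ⟩ := exists_X_pow_mem_denomIdeal φ 1
  have h1 : MvPolynomial.X 1 ^ m * P = MvPolynomial.X 0 ^ n * Q := by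
    apply ofPoly_top_injective
    rw [map_mul, map_mul, ← hP, ← hQ]
    ring
  have h2 : ¬ (MvPolynomial.X 0 : Poly) ∣ MvPolynomial.X 1 ^ m := by
    rintro ⟨r, hr⟩
    simpa using congrArg (MvPolynomial.eval ![0, 1]) hr
  obtain ⟨R, rfl⟩ := MvPolynomial.X_prime.pow_dvd_of_dvd_mul_left n h2 ⟨Q, h1⟩
  have h3 : Q = MvPolynomial.X 1 ^ m * R := by
    refine mul_left_cancel₀ (pow_ne_zero n (MvPolynomial.X_ne_zero (0 : Fin 2))) ?_
    rw [← h1]; ring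
  subst h3
  refine ⟨R, Reg.ext fun v => ?_⟩
  have h4 : v.1.1 0 ≠ 0 ∨ v.1.1 1 ≠ 0 := by
    by_contra! h
    refine v.1.2 (funext fun i => ?_)
    fin_cases i
    · exact h.1
    · exact h.2
  have hP' := congrArg (fun ψ : Reg ⊤ => ψ.1 v) hP
  have hQ' := congrArg (fun ψ : Reg ⊤ => ψ.1 v) hQ
  simp only [Reg.mul_val, ofPoly_val] at hP' hQ'
  simp only [map_mul, map_pow, MvPolynomial.eval_X] at hP' hQ'
  rcases h4 with h | h
  · exact (mul_left_cancel₀ (pow_ne_zero n h) hP').symm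
  · exact (mul_left_cancel₀ (pow_ne_zero m h) hQ').symm

/-- `Γ(X̃, 𝒪) = ℂ[x₁, x₂]`. -/
def polyEquiv : Poly ≃ₐ[ℂ] Reg ⊤ :=
  AlgEquiv.ofBijective (ofPoly ⊤) ⟨ofPoly_top_injective, ofPoly_top_surjective⟩

/-! ### The faithful action of `Γ(X, 𝒟̃)` on polynomials -/

/-- A differential operator which vanishes on polynomials vanishes on fractions `p / q`. -/
theorem isDiffOp_apply_eq_zero {W : Opens BaseAffine} (n : ℕ) :
    ∀ {T : Module.End ℂ (Reg W)}, IsDiffOp n T → (∀ p, T (ofPoly W p) = 0) →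
    ∀ {φ : Reg W} {p q : Poly}, ofPoly W q * φ = ofPoly W p →
    (∀ ψ, ofPoly W q * ψ = 0 → ψ = 0) → T φ = 0 := by
  have key : ∀ {T : Module.End ℂ (Reg W)} {φ : Reg W} {p q : Poly}, (∀ p, T (ofPoly W p) = 0) →
      ofPoly W q * φ = ofPoly W p → (∀ ψ, ofPoly W q * ψ = 0 → ψ = 0) →
      (T * LinearMap.mulLeft ℂ (ofPoly W q) - LinearMap.mulLeft ℂ (ofPoly W q) * T) φ = 0 →
      T φ = 0 := by
    intro T φ p q h0 hφ hq h1
    refine hq _ ?_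
    simp only [LinearMap.sub_apply, Module.End.mul_apply, LinearMap.mulLeft_apply, hφ, h0,
      zero_sub, neg_eq_zero] at h1
    exact h1
  induction n with
  | zero =>
    intro T hT h0 φ p q hφ hq
    exact key h0 hφ hq (by rw [hT]; rfl)
  | succ n ih =>
    intro T hT h0 φ p q hφ hq
    refine key h0 hφ hq (ih (hT (ofPoly W q)) ?_ hφ hq)
    intro r
    simp only [LinearMap.sub_apply, Module.End.mul_apply, LinearMap.mulLeft_apply, ← map_mul, h0,
      map_zero, sub_zero]

/-- The non-vanishing locus of `q` in `W`. -/
def basicOpen (W : Opens BaseAffine) (q : Poly) : Opens BaseAffine :=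
  W ⊓ ⟨{v | MvPolynomial.eval v.1 q ≠ 0}, isOpen_generateFrom_of_mem ⟨q, rfl⟩⟩

/-- The largest open subset of `X̃`, as an index for the sections of `𝒟̃` over `X`. -/
def topW : {W : Opens BaseAffine // W ≤ πInv ⊤} := ⟨⊤, fun _ _ => trivial⟩

/-- A global section of `𝒟̃` which vanishes on global functions is zero: locally every function is a
fraction of polynomials. -/
theorem GlobalDTilde.eq_zero {θ : GlobalDTilde} (hθ : ∀ p, θ.1.1 topW (ofPoly ⊤ p) = 0) :
    θ = 0 := by
  obtain ⟨n, hn⟩ := θ.1.2.2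
  refine GlobalDTilde.ext fun W φ v => ?_
  obtain ⟨p, q, hq, h1⟩ := φ.2 v
  let W₀ : {W : Opens BaseAffine // W ≤ πInv ⊤} := ⟨W, fun _ _ => trivial⟩
  let W' : {W : Opens BaseAffine // W ≤ πInv ⊤} := ⟨basicOpen W q, fun _ _ => trivial⟩
  have hle : W'.1 ≤ W := fun x hx => hx.1
  have h2 := θ.1.2.1 W₀ W' hle φ
  have h3 : θ.1.1 W' (Reg.res hle φ) = 0 := by
    refine isDiffOp_apply_eq_zero n (hn W') (fun r => ?_) (p := p) (q := q) ?_ ?_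
    · have h4 := θ.1.2.1 topW W' (fun _ _ => trivial) (ofPoly ⊤ r)
      rw [hθ, map_zero] at h4
      exact h4
    · refine Reg.ext fun y => ?_
      have hy : MvPolynomial.eval y.1.1 q ≠ 0 := y.2.2
      have h4 : φ.1 ⟨y.1, hle y.2⟩ = _ := h1 ⟨y.1, hle y.2⟩ hy
      rw [Reg.mul_val, Reg.res_val, h4, ofPoly_val, ofPoly_val]
      field_simp
    · intro ψ hψ
      refine Reg.ext fun y => ?_
      have hy : MvPolynomial.eval y.1.1 q ≠ 0 := y.2.2
      have h4 : (ofPoly W'.1 q * ψ).1 y = 0 := by rw [hψ]; rfl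
      exact (mul_eq_zero.1 h4).resolve_left hy
  rw [h3] at h2
  exact (congrArg (fun ψ : Reg W'.1 => ψ.1 ⟨v.1, v.2, hq⟩) h2).symm

/-- The action of `Γ(X, 𝒟̃)` on the algebra `ℂ[x₁, x₂]` of global functions on `X̃`. -/
def polyRep : GlobalDTilde →ₐ[ℂ] Module.End ℂ Poly :=
  (polyEquiv.symm.toLinearEquiv.conjAlgEquiv ℂ).toAlgHom.comp
    ((Pi.evalAlgHom ℂ (fun W : {W : Opens BaseAffine // W ≤ πInv ⊤} => Module.End ℂ (Reg W.1))
      topW).comp ((diffSubalgebra (πInv ⊤)).val.comp (dTildeSubalgebra ⊤).val))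

theorem polyRep_apply (θ : GlobalDTilde) (p : Poly) :
    polyRep θ p = polyEquiv.symm (θ.1.1 topW (polyEquiv p)) := rfl

theorem ofPoly_polyRep (θ : GlobalDTilde) (p : Poly) :
    ofPoly ⊤ (polyRep θ p) = θ.1.1 topW (ofPoly ⊤ p) := by
  rw [polyRep_apply]
  exact polyEquiv.apply_symm_apply _

theorem polyRep_injective : Function.Injective polyRep := by
  rw [injective_iff_map_eq_zero]
  intro θ hθ
  refine GlobalDTilde.eq_zero fun p => ?_
  rw [← ofPoly_polyRep, hθ, LinearMap.zero_apply]
  exact map_zero (ofPoly ⊤)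

/-- The operator `x_i ∂_j` on polynomials. -/
def coordEnd (i j : Fin 2) : Module.End ℂ Poly :=
  LinearMap.mulLeft ℂ (MvPolynomial.X i) * (MvPolynomial.pderiv (R := ℂ) j).toLinearMap

theorem coordEnd_apply (i j : Fin 2) (p : Poly) :
    coordEnd i j p = MvPolynomial.X i * MvPolynomial.pderiv j p := rfl

theorem polyRep_coordOp (i j : Fin 2) : polyRep (coordOp i j) = coordEnd i j := by
  refine LinearMap.ext fun p => ofPoly_top_injective ?_
  rw [ofPoly_polyRep, coordEnd_apply, map_mul, ← partialD_ofPoly]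
  rfl

/-- Transport of differential operators along an isomorphism of algebras. -/
theorem IsDiffOp.conj {A B : Type} [CommRing A] [Algebra ℂ A] [CommRing B] [Algebra ℂ B]
    (ε : A ≃ₐ[ℂ] B) (n : ℕ) : ∀ {T : Module.End ℂ B} {T' : Module.End ℂ A},
    (∀ a, ε (T' a) = T (ε a)) → IsDiffOp n T → IsDiffOp n T' := by
  have key : ∀ {T : Module.End ℂ B} {T' : Module.End ℂ A}, (∀ a, ε (T' a) = T (ε a)) →
      ∀ a b, ε ((T' * LinearMap.mulLeft ℂ a - LinearMap.mulLeft ℂ a * T') b) =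
        (T * LinearMap.mulLeft ℂ (ε a) - LinearMap.mulLeft ℂ (ε a) * T) (ε b) := by
    intro T T' hT a b
    simp [hT]
  induction n with
  | zero =>
    intro T T' hT h a
    refine LinearMap.ext fun b => ε.injective ?_
    rw [key hT, h (ε a)]
    simp
  | succ n ih =>
    intro T T' hT h a
    exact ih (key hT a) (h (ε a))

theorem exists_isDiffOp_polyRep (θ : GlobalDTilde) : ∃ n, IsDiffOp n (polyRep θ) := by
  obtain ⟨n, hn⟩ := θ.1.2.2
  exact ⟨n, IsDiffOp.conj polyEquiv n (ofPoly_polyRep θ) (hn topW)⟩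

/-- The substitution `x_i ↦ c x_i`. -/
def scale (c : ℂ) : Poly →ₐ[ℂ] Poly :=
  MvPolynomial.aeval fun i => MvPolynomial.C c * MvPolynomial.X i

theorem coeff_scale (c : ℂ) (p : Poly) (m : Fin 2 →₀ ℕ) :
    MvPolynomial.coeff m (scale c p) = c ^ m.degree * MvPolynomial.coeff m p := by
  induction p using MvPolynomial.induction_on' with
  | monomial u a =>
    have h1 : scale c (MvPolynomial.monomial u a) = MvPolynomial.monomial u (c ^ u.degree * a) := by
      rw [scale, MvPolynomial.aeval_monomial, MvPolynomial.monomial_eq (s := u)]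
      simp only [mul_pow, Finsupp.prod_mul, map_mul, MvPolynomial.algebraMap_eq]
      rw [Finsupp.degree_eq_sum, Finsupp.prod_fintype _ _ (by simp), ← Finset.prod_pow_eq_pow_sum]
      simp only [map_prod, map_pow]
      ring
    rw [h1, MvPolynomial.coeff_monomial, MvPolynomial.coeff_monomial]
    split_ifs with h
    · rw [h]
    · simp
  | add p q hp hq => rw [map_add, MvPolynomial.coeff_add, hp, hq, MvPolynomial.coeff_add, mul_add]

theorem scale_of_isHomogeneous (c : ℂ) {p : Poly} {d : ℕ} (hp : p.IsHomogeneous d) :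
    scale c p = c ^ d • p := by
  ext m
  rw [coeff_scale, MvPolynomial.coeff_smul, smul_eq_mul]
  by_cases hm : MvPolynomial.coeff m p = 0
  · simp [hm]
  · rw [← hp hm, Finsupp.degree_eq_weight_one]; rfl

theorem isHomogeneous_of_scale {p : Poly} {d : ℕ} (hp : scale 2 p = (2 : ℂ) ^ d • p) :
    p.IsHomogeneous d := by
  intro m hm
  have h1 := congrArg (MvPolynomial.coeff m) hp
  rw [coeff_scale, MvPolynomial.coeff_smul, smul_eq_mul] at h1
  have h2 := mul_right_cancel₀ hm h1
  have h3 : m.degree = d := by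
    have h4 : ((2 ^ m.degree : ℕ) : ℂ) = ((2 ^ d : ℕ) : ℂ) := by push_cast; exact h2
    exact Nat.pow_right_injective le_rfl (Nat.cast_injective h4)
  rw [← h3, Finsupp.degree_eq_weight_one]; rfl

/-- The element `diag(2, 1/2)` of `H`.  As `2` is not a root of unity, its eigenspaces on
polynomials are the homogeneous components. -/
def diagTwo : H :=
  ⟨⟨!![2, 0; 0, 2⁻¹], by simp [Matrix.det_fin_two]⟩, by constructor <;> simp⟩

/-- Invariance under `H` means that homogeneous polynomials are preserved. -/
theorem isHomogeneous_polyRep (θ : GlobalDTilde) {p : Poly} {d : ℕ} (hp : p.IsHomogeneous d) :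
    (polyRep θ p).IsHomogeneous d := by
  have hact : ∀ q : Poly, Reg.act diagTwo ⊤ (ofPoly ⊤ q) =
      Reg.res (V := translate diagTwo ⊤) (fun _ h => h) (ofPoly ⊤ (scale 2 q)) := by
    intro q
    refine Reg.ext fun v => ?_
    exact eval_rightAct diagTwo v.1 q
  have h1 := θ.2 diagTwo topW (ofPoly ⊤ p)
  have h2 : θ.1.1 ⟨translate diagTwo ⊤, fun _ _ => trivial⟩
      (Reg.act diagTwo ⊤ (ofPoly ⊤ p)) = Reg.act diagTwo ⊤ (ofPoly ⊤ (polyRep θ p)) := by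
    rw [ofPoly_polyRep]; exact h1
  rw [hact, hact] at h2
  have h3 := θ.1.2.1 topW ⟨translate diagTwo ⊤, fun _ _ => trivial⟩ (fun _ _ => trivial)
    (ofPoly ⊤ (scale 2 p))
  have h4 := h3.symm.trans h2
  rw [← ofPoly_polyRep] at h4
  refine isHomogeneous_of_scale ?_
  rw [← map_smul, ← scale_of_isHomogeneous 2 hp]
  refine ofPoly_top_injective (Reg.ext fun v => ?_)
  exact (congrArg (fun ψ : Reg (translate diagTwo ⊤) => ψ.1 ⟨v.1, trivial⟩) h4).symm

/-! ### Invariant differential operators on `ℂ[x₁, x₂]` -/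

/-- The monomial `x₁^i x₂^j`. -/
def mon (i j : ℕ) : Poly := MvPolynomial.X 0 ^ i * MvPolynomial.X 1 ^ j

theorem isHomogeneous_mon (i j : ℕ) : (mon i j).IsHomogeneous (i + j) :=
  (MvPolynomial.isHomogeneous_X_pow 0 i).mul (MvPolynomial.isHomogeneous_X_pow 1 j)

theorem monomial_eq_smul_mon (s : Fin 2 →₀ ℕ) (a : ℂ) :
    MvPolynomial.monomial s a = a • mon (s 0) (s 1) := by
  rw [MvPolynomial.monomial_eq, Finsupp.prod_fintype _ _ (by simp), Fin.prod_univ_two,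
    MvPolynomial.smul_eq_C_mul, mon]

/-- Linear maps on polynomials are equal if they agree on monomials. -/
theorem poly_hom_ext {M : Type} [AddCommGroup M] [Module ℂ M] {S T : Poly →ₗ[ℂ] M}
    (h : ∀ i j, S (mon i j) = T (mon i j)) : S = T := by
  refine LinearMap.ext fun p => ?_
  induction p using MvPolynomial.induction_on' with
  | monomial u a => rw [monomial_eq_smul_mon, map_smul, map_smul, h]
  | add p q hp hq => rw [map_add, map_add, hp, hq]

/-- The coefficient of `x₁^i x₂^j`. -/
def coeffAt (i j : ℕ) : Poly →ₗ[ℂ] ℂ :=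
  MvPolynomial.lcoeff ℂ (Finsupp.equivFunOnFinite.symm ![i, j])

theorem coeffAt_mon (i j a b : ℕ) : coeffAt i j (mon a b) = if a = i ∧ b = j then 1 else 0 := by
  have h1 : mon a b = MvPolynomial.monomial (Finsupp.equivFunOnFinite.symm ![a, b]) 1 := by
    simp [monomial_eq_smul_mon]
  rw [h1, coeffAt, MvPolynomial.lcoeff_apply, MvPolynomial.coeff_monomial]
  simp

theorem poly_ext {p q : Poly} (h : ∀ i j, coeffAt i j p = coeffAt i j q) : p = q := by
  refine MvPolynomial.ext _ _ fun m => ?_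
  have h1 := h (m 0) (m 1)
  have h2 : Finsupp.equivFunOnFinite.symm ![m 0, m 1] = m := by
    ext i; fin_cases i <;> simp
  rwa [coeffAt, MvPolynomial.lcoeff_apply, MvPolynomial.lcoeff_apply, h2] at h1

theorem coeffAt_eq_zero {p : Poly} {d i j : ℕ} (hp : p.IsHomogeneous d) (hij : i + j ≠ d) :
    coeffAt i j p = 0 := by
  rw [coeffAt, MvPolynomial.lcoeff_apply]
  refine hp.coeff_eq_zero ?_
  rw [Finsupp.degree_eq_sum]
  simpa using hij

/-- The partial derivative `∂_j` of polynomials. -/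
def dEnd (j : Fin 2) : Module.End ℂ Poly := (MvPolynomial.pderiv (R := ℂ) j).toLinearMap

theorem dEnd_apply (j : Fin 2) (p : Poly) : dEnd j p = MvPolynomial.pderiv j p := rfl

theorem dEnd_zero_mon (i j : ℕ) : dEnd 0 (mon i j) = (i : ℂ) • mon (i - 1) j := by
  rw [dEnd_apply, mon, mon, MvPolynomial.smul_eq_C_mul]
  simp [Derivation.leibniz, Derivation.leibniz_pow, MvPolynomial.pderiv_X]
  ring

theorem dEnd_one_mon (i j : ℕ) : dEnd 1 (mon i j) = (j : ℂ) • mon i (j - 1) := by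
  rw [dEnd_apply, mon, mon, MvPolynomial.smul_eq_C_mul]
  simp [Derivation.leibniz, Derivation.leibniz_pow, MvPolynomial.pderiv_X]
  ring

theorem dEnd_zero_pow_mon (b i j : ℕ) :
    (dEnd 0 ^ b) (mon i j) = (i.descFactorial b : ℂ) • mon (i - b) j := by
  induction b with
  | zero => simp
  | succ b ih =>
    rw [pow_succ', Module.End.mul_apply, ih, map_smul, dEnd_zero_mon, smul_smul,
      Nat.descFactorial_succ, Nat.sub_sub]
    push_cast
    rw [mul_comm]

theorem dEnd_one_pow_mon (b i j : ℕ) :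
    (dEnd 1 ^ b) (mon i j) = (j.descFactorial b : ℂ) • mon i (j - b) := by
  induction b with
  | zero => simp
  | succ b ih =>
    rw [pow_succ', Module.End.mul_apply, ih, map_smul, dEnd_one_mon, smul_smul,
      Nat.descFactorial_succ, Nat.sub_sub]
    push_cast
    rw [mul_comm]

/-- The operator `p ∂₁^a ∂₂^b`. -/
def weylOp (p : Poly) (a b : ℕ) : Module.End ℂ Poly :=
  LinearMap.mulLeft ℂ p * (dEnd 0 ^ a * dEnd 1 ^ b)

theorem weylOp_mon (p : Poly) (a b i j : ℕ) : weylOp p a b (mon i j) =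
    ((i.descFactorial a : ℂ) * (j.descFactorial b : ℂ)) • (p * mon (i - a) (j - b)) := by
  rw [weylOp, Module.End.mul_apply, Module.End.mul_apply, dEnd_one_pow_mon, map_smul,
    dEnd_zero_pow_mon, smul_smul, LinearMap.mulLeft_apply, mul_smul_comm,
    mul_comm (j.descFactorial b : ℂ)]

/-- In degrees at most `a + b`, only the monomial `x₁^a x₂^b` is not killed by `p ∂₁^a ∂₂^b`. -/
theorem weylOp_mon_eq_zero (p : Poly) {a b i j : ℕ} (hle : i + j ≤ a + b)
    (hne : ¬ (i = a ∧ j = b)) : weylOp p a b (mon i j) = 0 := by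
  rw [weylOp_mon]
  have : i < a ∨ j < b := by omega
  rcases this with h | h
  · simp [Nat.descFactorial_eq_zero_iff_lt.2 h]
  · simp [Nat.descFactorial_eq_zero_iff_lt.2 h]

theorem weylOp_mon_self (p : Poly) (a b : ℕ) : weylOp p a b (mon a b) =
    ((a.factorial : ℂ) * (b.factorial : ℂ)) • p := by
  rw [weylOp_mon]
  simp [mon, Nat.descFactorial_self]

theorem isDiffOp_mulLeft {A : Type} [CommRing A] [Algebra ℂ A] (a : A) :
    IsDiffOp 0 (LinearMap.mulLeft ℂ a) := by
  intro b
  ext c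
  simp
  ring

theorem IsDiffOp.pow {A : Type} [CommRing A] [Algebra ℂ A] {T : Module.End ℂ A}
    (hT : IsDiffOp 1 T) (n : ℕ) : IsDiffOp n (T ^ n) := by
  induction n with
  | zero => intro a; simp
  | succ n ih => rw [pow_succ]; exact IsDiffOp.mul _ rfl ih hT

theorem isDiffOp_weylOp (p : Poly) (a b : ℕ) : IsDiffOp (a + b) (weylOp p a b) :=
  IsDiffOp.mul _ (zero_add _) (isDiffOp_mulLeft p)
    (IsDiffOp.mul _ rfl ((isDiffOp_derivation _).pow a) ((isDiffOp_derivation _).pow b))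

/-- The algebra generated by the operators `x_i ∂_j` on polynomials. -/
def coordAlg : Subalgebra ℂ (Module.End ℂ Poly) :=
  Algebra.adjoin ℂ (Set.range fun ij : Fin 2 × Fin 2 => coordEnd ij.1 ij.2)

theorem coordEnd_mem (i j : Fin 2) : coordEnd i j ∈ coordAlg := Algebra.subset_adjoin ⟨(i, j), rfl⟩

theorem IsHomogeneous.exists_eq_C {p : Poly} (hp : p.IsHomogeneous 0) :
    ∃ c, p = MvPolynomial.C c := by
  refine ⟨_, MvPolynomial.totalDegree_eq_zero_iff_eq_C.1 ?_⟩
  by_cases h0 : p = 0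
  · simp [h0]
  · exact hp.totalDegree h0

theorem IsHomogeneous.X_mul_pderiv {p : Poly} {k : ℕ} (hp : p.IsHomogeneous k) (i j : Fin 2) :
    (MvPolynomial.X i * MvPolynomial.pderiv j p).IsHomogeneous k := by
  rcases k with _ | k
  · obtain ⟨c, rfl⟩ := IsHomogeneous.exists_eq_C hp
    simpa using MvPolynomial.isHomogeneous_zero _ _ _
  · have := (MvPolynomial.isHomogeneous_X ℂ i).mul (hp.pderiv (i := j))
    rwa [Nat.add_sub_cancel, add_comm] at this

/-- The operators `p ∂^β` with `p` homogeneous of degree `|β|` are polynomials in the `x_i ∂_j`,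
by induction on the degree: `x_i q ∂_j ∂^β = (x_i ∂_j) q ∂^β - x_i (∂_j q) ∂^β`. -/
theorem weylOp_mem (k : ℕ) : ∀ (p : Poly) (a b : ℕ), p.IsHomogeneous k → a + b = k →
    weylOp p a b ∈ coordAlg := by
  have key : ∀ (i j : Fin 2) (q : Poly) (D : Module.End ℂ Poly),
      LinearMap.mulLeft ℂ (MvPolynomial.X i * q) * (dEnd j * D) =
        coordEnd i j * (LinearMap.mulLeft ℂ q * D) -
        LinearMap.mulLeft ℂ (MvPolynomial.X i * MvPolynomial.pderiv j q) * D := by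
    intro i j q D
    refine LinearMap.ext fun p => ?_
    simp [coordEnd_apply, dEnd_apply]
    ring
  induction k with
  | zero =>
    intro p a b hp hab
    obtain ⟨rfl, rfl⟩ : a = 0 ∧ b = 0 := by omega
    obtain ⟨c, rfl⟩ := IsHomogeneous.exists_eq_C hp
    have : weylOp (MvPolynomial.C c) 0 0 = algebraMap ℂ _ c := by
      refine LinearMap.ext fun p => ?_
      simp [weylOp, Module.algebraMap_end_apply, MvPolynomial.smul_eq_C_mul]
    rw [this]
    exact coordAlg.algebraMap_mem c
  | succ k ih =>
    have step : ∀ (i : Fin 2) (q : Poly) (a b : ℕ), q.IsHomogeneous k → a + b = k + 1 →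
        weylOp (MvPolynomial.X i * q) a b ∈ coordAlg := by
      intro i q a b hq hab
      rcases a with _ | a
      · obtain rfl : b = k + 1 := by omega
        have h1 := key i 1 q (dEnd 0 ^ 0 * dEnd 1 ^ k)
        have h2 : weylOp (MvPolynomial.X i * q) 0 (k + 1) =
            coordEnd i 1 * weylOp q 0 k -
              weylOp (MvPolynomial.X i * MvPolynomial.pderiv 1 q) 0 k := by
          rw [weylOp, weylOp, weylOp, ← h1, pow_succ', pow_zero, one_mul, one_mul]
        rw [h2]
        exact sub_mem (mul_mem (coordEnd_mem _ _) (ih _ _ _ hq (by omega)))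
          (ih _ _ _ (IsHomogeneous.X_mul_pderiv hq _ _) (by omega))
      · have h1 := key i 0 q (dEnd 0 ^ a * dEnd 1 ^ b)
        have h2 : weylOp (MvPolynomial.X i * q) (a + 1) b =
            coordEnd i 0 * weylOp q a b -
              weylOp (MvPolynomial.X i * MvPolynomial.pderiv 0 q) a b := by
          rw [weylOp, weylOp, weylOp, ← h1, pow_succ', mul_assoc (dEnd 0)]
        rw [h2]
        exact sub_mem (mul_mem (coordEnd_mem _ _) (ih _ _ _ hq (by omega)))
          (ih _ _ _ (IsHomogeneous.X_mul_pderiv hq _ _) (by omega))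
    intro p a b hp hab
    -- Euler's identity writes `p` as a combination of multiples of the variables
    have h1 := hp.sum_X_mul_pderiv
    rw [Fin.sum_univ_two] at h1
    have h2 : weylOp p a b = ((k + 1 : ℕ) : ℂ)⁻¹ •
        (weylOp (MvPolynomial.X 0 * MvPolynomial.pderiv 0 p) a b +
          weylOp (MvPolynomial.X 1 * MvPolynomial.pderiv 1 p) a b) := by
      refine LinearMap.ext fun q => ?_
      have h0 : ((k + 1 : ℕ) : ℂ) ≠ 0 := Nat.cast_ne_zero.2 (Nat.succ_ne_zero k)
      rw [LinearMap.smul_apply, eq_inv_smul_iff₀ h0]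
      simp only [weylOp, Module.End.mul_apply, LinearMap.add_apply, LinearMap.mulLeft_apply,
        ← add_mul, h1]
      rw [← smul_mul_assoc, Nat.cast_smul_eq_nsmul]
    rw [h2]
    have h3 : ∀ j : Fin 2, (MvPolynomial.pderiv j p).IsHomogeneous k := fun j => hp.pderiv
    exact coordAlg.smul_mem (add_mem (step _ _ _ _ (h3 0) hab) (step _ _ _ _ (h3 1) hab)) _

/-- A differential operator of order at most `n` on polynomials is determined by its values on
polynomials of degree at most `n`. -/
theorem isDiffOp_eq_zero (n : ℕ) : ∀ {T : Module.End ℂ Poly}, IsDiffOp n T →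
    (∀ i j, i + j ≤ n → T (mon i j) = 0) → T = 0 := by
  have key : ∀ {T : Module.End ℂ Poly}, (∀ i : Fin 2,
      T * LinearMap.mulLeft ℂ (MvPolynomial.X i) - LinearMap.mulLeft ℂ (MvPolynomial.X i) * T = 0) →
      T (mon 0 0) = 0 → T = 0 := by
    intro T hT h1
    refine LinearMap.ext fun p => ?_
    induction p using MvPolynomial.induction_on with
    | C a =>
      have : (MvPolynomial.C a : Poly) = a • mon 0 0 := by simp [mon, MvPolynomial.smul_eq_C_mul]
      rw [this, map_smul, h1, smul_zero, LinearMap.zero_apply]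
    | add p q hp hq => rw [map_add, hp, hq, map_add]
    | mul_X p i hp =>
      have := LinearMap.congr_fun (hT i) p
      rw [LinearMap.zero_apply] at hp
      simp only [LinearMap.sub_apply, Module.End.mul_apply, LinearMap.mulLeft_apply, hp, mul_zero,
        sub_zero] at this
      rw [mul_comm]
      exact this
  induction n with
  | zero =>
    intro T hT h0
    exact key (fun i => hT _) (h0 0 0 le_rfl)
  | succ n ih =>
    intro T hT h0
    refine key (fun i => ih (hT _) ?_) (h0 0 0 (by omega))
    intro a b hab
    have h1 : ∃ c d, c + d = a + b + 1 ∧ MvPolynomial.X i * mon a b = mon c d := by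
      fin_cases i
      · exact ⟨a + 1, b, by omega, by simp [mon]; ring⟩
      · exact ⟨a, b + 1, by omega, by simp [mon]; ring⟩
    obtain ⟨c, d, hcd, h2⟩ := h1
    simp only [LinearMap.sub_apply, Module.End.mul_apply, LinearMap.mulLeft_apply, h2,
      h0 c d (by omega), h0 a b (by omega), mul_zero, sub_zero]

/-- A differential operator which preserves degrees is a polynomial in the `x_i ∂_j`: subtract
operators `p ∂^β` with `p` homogeneous of degree `|β|` to kill, one after another, the monomials of
degree at most the order of the operator. -/
theorem mem_coordAlg (n : ℕ) (m : ℕ) : ∀ {T : Module.End ℂ Poly} (k : ℕ), k + m = n + 1 →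
    IsDiffOp n T → (∀ i j, (T (mon i j)).IsHomogeneous (i + j)) →
    (∀ i j, i + j < k → T (mon i j) = 0) → T ∈ coordAlg := by
  induction m with
  | zero =>
    intro T k hk hT _ h0
    rw [isDiffOp_eq_zero n hT fun i j hij => h0 i j (by omega)]
    exact zero_mem _
  | succ m ih =>
    intro T k hk hT hd h0
    let c : ℕ → ℂ := fun i => ((i.factorial : ℂ) * ((k - i).factorial : ℂ))⁻¹
    let R : Module.End ℂ Poly :=
      ∑ i ∈ Finset.range (k + 1), c i • weylOp (T (mon i (k - i))) i (k - i)
    have hsmul : ∀ (c : ℂ) {S : Module.End ℂ Poly}, IsDiffOp n S → IsDiffOp n (c • S) := by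
      intro c S hS
      rw [Algebra.smul_def]
      exact IsDiffOp.mul n (zero_add n) (IsDiffOp.algebraMap c) hS
    have hR : R ∈ coordAlg := by
      refine sum_mem fun i hi => coordAlg.smul_mem (weylOp_mem k _ _ _ ?_ ?_) _
      · have := hd i (k - i)
        rwa [Nat.add_sub_cancel' (Finset.mem_range_succ_iff.1 hi)] at this
      · exact Nat.add_sub_cancel' (Finset.mem_range_succ_iff.1 hi)
    have hRd : IsDiffOp n R := by
      refine Finset.sum_induction _ (IsDiffOp n) (fun _ _ => IsDiffOp.add) (IsDiffOp.zero n) ?_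
      intro i hi
      have := Finset.mem_range_succ_iff.1 hi
      exact hsmul _ ((isDiffOp_weylOp _ _ _).mono (by omega))
    have hRh : ∀ S ∈ coordAlg, ∀ d p, p ∈ MvPolynomial.homogeneousSubmodule (Fin 2) ℂ d →
        S p ∈ MvPolynomial.homogeneousSubmodule (Fin 2) ℂ d := by
      intro S hS
      induction hS using Algebra.adjoin_induction with
      | mem S hS =>
        obtain ⟨ij, rfl⟩ := hS
        intro d p hp
        exact IsHomogeneous.X_mul_pderiv hp _ _
      | algebraMap r => intro d p hp; exact Submodule.smul_mem _ _ hp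
      | add S S' _ _ h1 h2 => intro d p hp; exact add_mem (h1 d p hp) (h2 d p hp)
      | mul S S' _ _ h1 h2 => intro d p hp; exact h1 d _ (h2 d p hp)
    have hRv : ∀ i j, i + j < k + 1 → R (mon i j) = T (mon i j) := by
      intro i j hij
      simp only [R, LinearMap.sum_apply, LinearMap.smul_apply]
      by_cases hk' : i + j = k
      · obtain rfl : j = k - i := by omega
        rw [Finset.sum_eq_single i]
        · rw [weylOp_mon_self, smul_smul, inv_mul_cancel₀, one_smul]
          exact mul_ne_zero (Nat.cast_ne_zero.2 (Nat.factorial_ne_zero _))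
            (Nat.cast_ne_zero.2 (Nat.factorial_ne_zero _))
        · intro b hb hne
          have := Finset.mem_range_succ_iff.1 hb
          rw [weylOp_mon_eq_zero _ (by omega) (fun h => hne h.1.symm), smul_zero]
        · intro h; exact absurd (Finset.mem_range.2 (by omega)) h
      · rw [h0 i j (by omega)]
        refine Finset.sum_eq_zero fun b hb => ?_
        have := Finset.mem_range_succ_iff.1 hb
        rw [weylOp_mon_eq_zero _ (by omega) (by omega), smul_zero]
    have hneg : IsDiffOp n ((-1 : ℂ) • R) := hsmul _ hRd
    have h1 : T - R ∈ coordAlg := by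
      refine ih (k + 1) (by omega) ?_ (fun i j => ?_) (fun i j hij => ?_)
      · rw [sub_eq_add_neg, ← neg_one_smul ℂ R]; exact hT.add hneg
      · exact (MvPolynomial.homogeneousSubmodule (Fin 2) ℂ (i + j)).sub_mem (hd i j)
          (hRh R hR _ _ (isHomogeneous_mon i j))
      · rw [LinearMap.sub_apply, hRv i j hij, sub_self]
    rw [← sub_add_cancel T R]
    exact add_mem h1 hR

/-- The operators `x_i ∂_j` generate `Γ(X, 𝒟̃)`. -/
theorem adjoin_coordOp :
    Algebra.adjoin ℂ (Set.range fun ij : Fin 2 × Fin 2 => coordOp ij.1 ij.2) = ⊤ := by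
  rw [eq_top_iff]
  intro θ _
  obtain ⟨n, hn⟩ := exists_isDiffOp_polyRep θ
  have h1 : polyRep θ ∈ coordAlg := mem_coordAlg n (n + 1) 0 (by omega) hn
    (fun i j => isHomogeneous_polyRep θ (isHomogeneous_mon i j)) (by simp)
  have h2 : coordAlg = (Algebra.adjoin ℂ
      (Set.range fun ij : Fin 2 × Fin 2 => coordOp ij.1 ij.2)).map polyRep := by
    rw [AlgHom.map_adjoin, ← Set.range_comp, coordAlg]
    simp only [Function.comp_def, polyRep_coordOp]
  rw [h2] at h1
  obtain ⟨η, hη, h3⟩ := h1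
  exact polyRep_injective h3 ▸ hη

/-! ### The vector fields `L_x` and `R_y` -/

/-- The commutation relations of `𝔤𝔩₂`. -/
theorem coordOp_commutator (i j k l : Fin 2) :
    coordOp i j * coordOp k l - coordOp k l * coordOp i j =
      (if j = k then coordOp i l else 0) - (if i = l then coordOp k j else 0) := by
  apply polyRep_injective
  let D : Fin 2 → Fin 2 → Derivation ℂ Poly Poly := fun i j =>
    (MvPolynomial.X i : Poly) • MvPolynomial.pderiv j
  have hD : ∀ i j p, coordEnd i j p = D i j p := fun _ _ _ => rfl
  have h1 : ⁅D i j, D k l⁆ = (if j = k then D i l else 0) - (if i = l then D k j else 0) := by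
    refine MvPolynomial.derivation_ext fun a => ?_
    rw [Derivation.commutator_apply]
    simp only [D, Derivation.smul_apply, MvPolynomial.pderiv_X, Derivation.sub_apply, smul_eq_mul]
    fin_cases i <;> fin_cases j <;> fin_cases k <;> fin_cases l <;> fin_cases a <;>
      simp [MvPolynomial.pderiv_X]
  refine LinearMap.ext fun p => ?_
  have h2 := Derivation.congr_fun h1 p
  rw [Derivation.commutator_apply] at h2
  simp only [map_sub, map_mul, polyRep_coordOp, LinearMap.sub_apply, Module.End.mul_apply, hD, h2,
    Derivation.sub_apply, apply_ite polyRep, map_zero]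
  split_ifs <;> simp [hD]

theorem apply_one_one (x : 𝔤) : x.1 1 1 = - x.1 0 0 := by
  have := x.2
  simp [LieAlgebra.SpecialLinear.sl, Matrix.trace] at this
  linear_combination this

/-- A triple of elements of an algebra satisfying the relations of `𝔰𝔩₂` defines a homomorphism
of Lie algebras. -/
def sl2Hom {A : Type} [Ring A] [Algebra ℂ A] (E F K : A) (hEF : E * F = F * E + K)
    (hKE : K * E = E * K + (2 : ℂ) • E) (hKF : K * F = F * K + (-2 : ℂ) • F) : 𝔤 →ₗ⁅ℂ⁆ A where
  toFun x := x.1 0 1 • E + x.1 1 0 • F + x.1 0 0 • K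
  map_add' x y := by simp [add_smul]; abel
  map_smul' c x := by simp [mul_smul]
  map_lie' := by
    intro x y
    rw [LieAlgebra.SpecialLinear.sl_bracket]
    have hx := apply_one_one x
    have hy := apply_one_one y
    simp only [LieRing.of_associative_ring_bracket, Matrix.sub_apply, Matrix.mul_apply,
      Fin.sum_univ_two, hx, hy, mul_add, add_mul, smul_mul_smul_comm, hEF, hKE, hKF]
    module

/-- The Euler vector field `x₁∂₁ + x₂∂₂`. -/
def euler : GlobalDTilde := coordOp 0 0 + coordOp 1 1

/-- The Euler vector field is central, since it commutes with the generators `x_i ∂_j`. -/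
theorem euler_comm (θ : GlobalDTilde) : Commute euler θ := by
  have h1 : θ ∈ Algebra.adjoin ℂ (Set.range fun ij : Fin 2 × Fin 2 => coordOp ij.1 ij.2) := by
    rw [adjoin_coordOp]; trivial
  induction h1 using Algebra.adjoin_induction with
  | mem θ hθ =>
    obtain ⟨⟨i, j⟩, rfl⟩ := hθ
    have h0 := coordOp_commutator 0 0 i j
    have h1 := coordOp_commutator 1 1 i j
    refine sub_eq_zero.1 ?_
    rw [euler, add_mul, mul_add, add_sub_add_comm, h0, h1]
    fin_cases i <;> fin_cases j <;> simp
  | algebraMap r => exact (Algebra.commutes r euler).symm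
  | add a b _ _ ha hb => exact ha.add_right hb
  | mul a b _ _ ha hb => exact ha.mul_right hb

/-- `x ↦ L_x` as a homomorphism of Lie algebras. -/
def vecL : 𝔤 →ₗ⁅ℂ⁆ GlobalDTilde :=
  sl2Hom (-coordOp 1 0) (-coordOp 0 1) (-coordOp 0 0 + coordOp 1 1)
    (by
      have h := coordOp_commutator 1 0 0 1
      simp only [if_true] at h
      rw [neg_mul_neg, neg_mul_neg, eq_add_of_sub_eq h]; abel)
    (by
      have h0 := eq_add_of_sub_eq (coordOp_commutator 0 0 1 0)
      have h1 := eq_add_of_sub_eq (coordOp_commutator 1 1 1 0)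
      simp at h0 h1
      simp only [add_mul, mul_add, mul_neg, neg_mul, h0, h1]
      module)
    (by
      have h0 := eq_add_of_sub_eq (coordOp_commutator 0 0 0 1)
      have h1 := eq_add_of_sub_eq (coordOp_commutator 1 1 0 1)
      simp at h0 h1
      simp only [add_mul, mul_add, mul_neg, neg_mul, h0, h1]
      module)

theorem vecL_apply (x : 𝔤) : vecL x = x.1 0 1 • (-coordOp 1 0) + x.1 1 0 • (-coordOp 0 1) +
    x.1 0 0 • (-coordOp 0 0 + coordOp 1 1) := rfl

theorem vecL_e : vecL e = -coordOp 1 0 := by simp [vecL_apply, e]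
theorem vecL_f : vecL f = -coordOp 0 1 := by simp [vecL_apply, f]
theorem vecL_h : vecL h = -coordOp 0 0 + coordOp 1 1 := by simp [vecL_apply, h]

/-- `y ↦ R_y` as a homomorphism of Lie algebras. -/
def vecR : 𝔥 →ₗ⁅ℂ⁆ GlobalDTilde where
  toFun y := y.1.1 0 0 • euler
  map_add' x y := by simp [add_smul]
  map_smul' c x := by simp [mul_smul]
  map_lie' := by
    intro x y
    have hxy : ⁅x, y⁆ = 0 := by
      obtain ⟨a, ha⟩ := Submodule.mem_span_singleton.1 x.2
      obtain ⟨b, hb⟩ := Submodule.mem_span_singleton.1 y.2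
      apply Subtype.ext
      rw [LieSubalgebra.coe_bracket, ← ha, ← hb]
      simp
    rw [hxy, LieRing.of_associative_ring_bracket, smul_mul_smul_comm, smul_mul_smul_comm,
      mul_comm (x.1.1 0 0), sub_self]
    simp

theorem vecR_apply (y : 𝔥) : vecR y = y.1.1 0 0 • euler := rfl

theorem vecR_h : vecR h𝔥 = euler := by simp [vecR_apply, h𝔥, h]

theorem GlobalDTilde.app_add (θ η : GlobalDTilde) {W : Opens BaseAffine} (φ : Reg W) (v : W) :
    (θ + η).app φ v = θ.app φ v + η.app φ v := rfl

theorem GlobalDTilde.app_neg (θ : GlobalDTilde) {W : Opens BaseAffine} (φ : Reg W) (v : W) :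
    (-θ).app φ v = -θ.app φ v := rfl

theorem GlobalDTilde.app_smul (c : ℂ) (θ : GlobalDTilde) {W : Opens BaseAffine} (φ : Reg W)
    (v : W) : (c • θ).app φ v = c * θ.app φ v := rfl

/-- The chain rule along a curve through a point of `W`. -/
theorem hasDerivAt_extend {W : Opens BaseAffine} (φ : Reg W) (v : W) {c : ℂ → Fin 2 → ℂ}
    {c' : Fin 2 → ℂ} (hc : HasDerivAt c c' 0) (h0 : c 0 = v.1.1) :
    HasDerivAt (fun t => extend φ (c t))
      (c' 0 * (partialD 0 W φ).1 v + c' 1 * (partialD 1 W φ).1 v) 0 := by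
  rw [← fderiv_extend_apply]
  have h1 := (differentiableAt_extend φ v).hasFDerivAt
  exact HasFDerivAt.comp_hasDerivAt_of_eq 0 h1 hc h0.symm

theorem expG_neg_eq_inv (x : 𝔤) : (expG x)⁻¹ = expG (-x) := by
  rw [inv_eq_iff_mul_eq_one]
  apply Subtype.ext
  change NormedSpace.exp x.1 * NormedSpace.exp (-x.1) = 1
  have h1 : Commute x.1 (-x.1) := (Commute.refl x.1).neg_right
  rw [← Matrix.exp_add_of_commute _ _ h1, add_neg_cancel, NormedSpace.exp_zero]

open NormedSpace in
theorem hasDerivAt_exp_entry (x : Matrix (Fin 2) (Fin 2) ℂ) (i j : Fin 2) :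
    HasDerivAt (fun t : ℂ => exp (t • x) i j) (x i j) 0 := by
  let _ : SeminormedRing (Matrix (Fin 2) (Fin 2) ℂ) := Matrix.linftyOpSemiNormedRing
  let _ : NormedRing (Matrix (Fin 2) (Fin 2) ℂ) := Matrix.linftyOpNormedRing
  let _ : NormedAlgebra ℂ (Matrix (Fin 2) (Fin 2) ℂ) := Matrix.linftyOpNormedAlgebra
  have h1 : HasDerivAt (fun t : ℂ => exp (t • x) i j) ((exp ((0 : ℂ) • x) * x) i j) 0 :=
    (((Matrix.entryLinearMap ℂ ℂ i j).toContinuousLinearMap).hasFDerivAt.comp_hasDerivAt 0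
      (hasDerivAt_exp_smul_const x 0) :)
  simpa using h1

theorem isL_vecL (x : 𝔤) : IsL x (vecL x) := by
  intro W φ v
  have hc : HasDerivAt (fun t : ℂ => (leftAct (expG (t • x))⁻¹ v).1)
      (Matrix.mulVec (-x.1) v.1.1) 0 := by
    refine hasDerivAt_pi.2 fun i => ?_
    have h1 := ((hasDerivAt_exp_entry (-x.1) i 0).mul_const (v.1.1 0)).fun_add
      ((hasDerivAt_exp_entry (-x.1) i 1).mul_const (v.1.1 1))
    have h2 : ∀ t : ℂ, (leftAct (expG (t • x))⁻¹ v).1 i =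
        NormedSpace.exp (t • -x.1) i 0 * v.1.1 0 + NormedSpace.exp (t • -x.1) i 1 * v.1.1 1 := by
      intro t
      have h3 : ((expG (t • x))⁻¹ : G).1 = NormedSpace.exp (t • -x.1) := by
        rw [expG_neg_eq_inv, smul_neg]; rfl
      change (Matrix.mulVec ((expG (t • x))⁻¹ : G).1 v.1.1) i = _
      rw [h3, Matrix.mulVec, dotProduct, Fin.sum_univ_two]
    have h4 : Matrix.mulVec (-x.1) v.1.1 i = (-x.1) i 0 * v.1.1 0 + (-x.1) i 1 * v.1.1 1 := by
      rw [Matrix.mulVec, dotProduct, Fin.sum_univ_two]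
    rw [h4]
    refine h1.congr_of_eventuallyEq (Filter.Eventually.of_forall h2)
  have h0 : (leftAct (expG ((0 : ℂ) • x))⁻¹ v).1 = v.1.1 := by
    have : expG ((0 : ℂ) • x) = 1 := by
      apply Subtype.ext
      simp [expG]
    rw [this]
    simp [leftAct]
  refine (hasDerivAt_extend φ v hc h0).congr_deriv ?_
  simp only [vecL_apply, GlobalDTilde.app_add, GlobalDTilde.app_neg, GlobalDTilde.app_smul,
    coordOp_app, Matrix.mulVec, dotProduct, Fin.sum_univ_two, Matrix.neg_apply,
    apply_one_one x]
  ring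

theorem isR_vecR (y : 𝔥) : IsR y (vecR y) := by
  intro W φ v
  have hc : HasDerivAt (fun t : ℂ => (rightAct v (expH (t • y))).1) (y.1.1 0 0 • v.1.1) 0 := by
    have h1 : ∀ t : ℂ, (rightAct v (expH (t • y))).1 = Complex.exp (t * y.1.1 0 0) • v.1.1 := by
      intro t
      obtain ⟨a, ha⟩ := Submodule.mem_span_singleton.1 y.2
      have h2 : ((t • y : 𝔥) : 𝔤).1 = Matrix.diagonal ![t * a, -(t * a)] := by
        change t • y.1.1 = _
        rw [← ha]
        ext i j
        fin_cases i <;> fin_cases j <;> simp [h]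
      have h3 : y.1.1 0 0 = a := by rw [← ha]; simp [h]
      change NormedSpace.exp ((t • y : 𝔥) : 𝔤).1 0 0 • v.1.1 = _
      rw [h2, h3, Matrix.exp_diagonal]
      simp [Complex.exp_eq_exp_ℂ]
    simp only [h1]
    have h2 : HasDerivAt (fun t : ℂ => Complex.exp (t * y.1.1 0 0)) (y.1.1 0 0) 0 := by
      simpa using ((hasDerivAt_id (0 : ℂ)).mul_const (y.1.1 0 0)).cexp
    exact h2.smul_const v.1.1
  have h0 : (rightAct v (expH ((0 : ℂ) • y))).1 = v.1.1 := by
    change NormedSpace.exp (((0 : ℂ) • y : 𝔥) : 𝔤).1 0 0 • v.1.1 = _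
    simp
  refine (hasDerivAt_extend φ v hc h0).congr_deriv ?_
  simp only [vecR_apply, euler, GlobalDTilde.app_add, GlobalDTilde.app_smul, coordOp_app,
    Pi.smul_apply, smul_eq_mul]
  ring

theorem IsL.unique {x : 𝔤} {θ η : GlobalDTilde} (hθ : IsL x θ) (hη : IsL x η) : θ = η :=
  GlobalDTilde.ext fun W φ v => (hθ W φ v).unique (hη W φ v)

theorem IsR.unique {y : 𝔥} {θ η : GlobalDTilde} (hθ : IsR y θ) (hη : IsR y η) : θ = η :=
  GlobalDTilde.ext fun W φ v => (hθ W φ v).unique (hη W φ v)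

/-! ### The homomorphism `α` -/

/-- The homomorphism `U(𝔤) → Γ(X, 𝒟̃)` extending `x ↦ L_x`. -/
def homL : U𝔤 →ₐ[ℂ] GlobalDTilde := UniversalEnvelopingAlgebra.lift ℂ vecL

/-- The homomorphism `U(𝔥) → Γ(X, 𝒟̃)` extending `y ↦ R_y`. -/
def homR : U𝔥 →ₐ[ℂ] GlobalDTilde := UniversalEnvelopingAlgebra.lift ℂ vecR

theorem homL_ι (x : 𝔤) : homL (ι𝔤 x) = vecL x := by simp [homL]

theorem homR_ι (y : 𝔥) : homR (ι𝔥 y) = vecR y := by simp [homR]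

theorem X_zero_mul_mon (i j : ℕ) : MvPolynomial.X 0 * mon i j = mon (i + 1) j := by
  simp only [mon, pow_succ]; ring

theorem X_one_mul_mon (i j : ℕ) : MvPolynomial.X 1 * mon i j = mon i (j + 1) := by
  simp only [mon, pow_succ]; ring

theorem polyRep_coordOp_apply (i j : Fin 2) (p : Poly) :
    polyRep (coordOp i j) p = MvPolynomial.X i * dEnd j p := by
  rw [polyRep_coordOp]; rfl

theorem polyRep_coordOp_zero_mon (i j : ℕ) :
    polyRep (coordOp 0 0) (mon i j) = (i : ℂ) • mon i j := by
  rw [polyRep_coordOp_apply, dEnd_zero_mon, mul_smul_comm, X_zero_mul_mon]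
  rcases i with _ | i <;> simp

theorem polyRep_coordOp_one_mon (i j : ℕ) :
    polyRep (coordOp 1 1) (mon i j) = (j : ℂ) • mon i j := by
  rw [polyRep_coordOp_apply, dEnd_one_mon, mul_smul_comm, X_one_mul_mon]
  rcases j with _ | j <;> simp

theorem polyRep_f_apply (p : Poly) : polyRep (vecL f) p = -(MvPolynomial.X 0 * dEnd 1 p) := by
  rw [vecL_f, map_neg, LinearMap.neg_apply, polyRep_coordOp_apply]

theorem polyRep_f_mon (i j : ℕ) :
    polyRep (vecL f) (mon i j) = (-(j : ℂ)) • mon (i + 1) (j - 1) := by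
  rw [polyRep_f_apply, dEnd_one_mon, mul_smul_comm, X_zero_mul_mon, neg_smul]

theorem polyRep_e_mon (i j : ℕ) :
    polyRep (vecL e) (mon i j) = (-(i : ℂ)) • mon (i - 1) (j + 1) := by
  rw [vecL_e, map_neg, LinearMap.neg_apply, polyRep_coordOp_apply, dEnd_zero_mon, mul_smul_comm,
    X_one_mul_mon, neg_smul]

theorem polyRep_h_mon (i j : ℕ) :
    polyRep (vecL h) (mon i j) = ((j : ℂ) - i) • mon i j := by
  rw [vecL_h, map_add, map_neg, LinearMap.add_apply, LinearMap.neg_apply,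
    polyRep_coordOp_zero_mon, polyRep_coordOp_one_mon]
  module

theorem polyRep_euler_mon (i j : ℕ) :
    polyRep euler (mon i j) = ((i : ℂ) + j) • mon i j := by
  rw [euler, map_add, LinearMap.add_apply, polyRep_coordOp_zero_mon, polyRep_coordOp_one_mon]
  module

theorem polyRep_homR_mon (P : Polynomial ℂ) (i j : ℕ) :
    polyRep (homR (Polynomial.aeval (ι𝔥 h𝔥) P)) (mon i j) = P.eval ((i : ℂ) + j) • mon i j := by
  rw [← Polynomial.aeval_algHom_apply, homR_ι, vecR_h, ← Polynomial.aeval_algHom_apply]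
  exact Module.End.aeval_apply_of_mem_apply_eq_smul (polyRep_euler_mon i j)

theorem polyRep_homL_inclU_mon (P : Polynomial ℂ) (i j : ℕ) :
    polyRep (homL (inclU (Polynomial.aeval (ι𝔥 h𝔥) P))) (mon i j) =
      P.eval ((j : ℂ) - i) • mon i j := by
  rw [← Polynomial.aeval_algHom_apply, ← Polynomial.aeval_algHom_apply, inclU_ι, homL_ι,
    ← Polynomial.aeval_algHom_apply]
  exact Module.End.aeval_apply_of_mem_apply_eq_smul (polyRep_h_mon i j)

theorem coeffAt_polyRep_h (i j : ℕ) (p : Poly) :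
    coeffAt i j (polyRep (vecL h) p) = ((j : ℂ) - i) * coeffAt i j p := by
  have h1 : coeffAt i j ∘ₗ polyRep (vecL h) = ((j : ℂ) - i) • coeffAt i j := by
    refine poly_hom_ext fun a b => ?_
    rw [LinearMap.comp_apply, polyRep_h_mon, map_smul, LinearMap.smul_apply, coeffAt_mon]
    split_ifs with hab
    · rw [hab.1, hab.2]
    · simp
  exact LinearMap.congr_fun h1 p

theorem coeffAt_polyRep_f (j : ℕ) (p : Poly) : coeffAt 0 j (polyRep (vecL f) p) = 0 := by
  have h1 : coeffAt 0 j ∘ₗ polyRep (vecL f) = 0 := by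
    refine poly_hom_ext fun a b => ?_
    rw [LinearMap.comp_apply, polyRep_f_mon, map_smul, coeffAt_mon, if_neg (by omega), smul_zero,
      LinearMap.zero_apply]
  exact LinearMap.congr_fun h1 p

theorem polyRep_f_pow_mon (k i j : ℕ) : (polyRep (vecL f) ^ k) (mon i j) =
    ((-1) ^ k * (j.descFactorial k : ℂ)) • mon (i + k) (j - k) := by
  induction k with
  | zero => simp
  | succ k ih =>
    rw [pow_succ', Module.End.mul_apply, ih, map_smul, polyRep_f_mon, smul_smul,
      Nat.descFactorial_succ, Nat.sub_sub, pow_succ]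
    push_cast
    congr 1
    ring

theorem polyRep_e_pow_mon (k i j : ℕ) : (polyRep (vecL e) ^ k) (mon i j) =
    ((-1) ^ k * (i.descFactorial k : ℂ)) • mon (i - k) (j + k) := by
  induction k with
  | zero => simp
  | succ k ih =>
    rw [pow_succ', Module.End.mul_apply, ih, map_smul, polyRep_e_mon, smul_smul,
      Nat.descFactorial_succ, Nat.sub_sub, pow_succ]
    push_cast
    congr 1
    ring

/-- A central element acts on `x₂^d`, the vector of weight `d` killed by `e` in the irreducible
representation of degree `d` polynomials, by the value at `d` of its Harish-Chandra projection. -/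
theorem polyRep_homL_center_highest (z : Z𝔤) {P : Polynomial ℂ}
    (hP : γHC z = Polynomial.aeval (ι𝔥 h𝔥) P) (d : ℕ) :
    polyRep (homL z) (mon 0 d) = P.eval (d : ℂ) • mon 0 d := by
  -- centrality makes the image a vector of the same weight, hence a multiple of `x₂^d`
  have hw : polyRep (vecL h) (polyRep (homL z) (mon 0 d)) =
      (d : ℂ) • polyRep (homL z) (mon 0 d) := by
    have h1 := congrArg (fun u => polyRep (homL u) (mon 0 d))
      (Subalgebra.mem_center_iff.1 z.2 (ι𝔤 h))
    simp only [map_mul, homL_ι, Module.End.mul_apply, polyRep_h_mon, map_smul] at h1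
    rw [h1]
    simp
  have hd := isHomogeneous_polyRep (homL z) (isHomogeneous_mon 0 d)
  -- the remaining coefficient is read off from the Harish-Chandra decomposition
  obtain ⟨_, ⟨u, rfl⟩, _, ⟨w, rfl⟩, huw⟩ := Submodule.mem_sup.1 (sub_γHC_mem (z : U𝔤))
  have h2 : polyRep (homL z) (mon 0 d) = P.eval (d : ℂ) • mon 0 d +
      polyRep (vecL f) (polyRep (homL u) (mon 0 d)) := by
    rw [hP, eq_sub_iff_add_eq] at huw
    have h3 : polyRep (homL w) (polyRep (vecL e) (mon 0 d)) = 0 := by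
      rw [polyRep_e_mon]; simp
    rw [← huw]
    simp only [map_add, LinearMap.add_apply, LinearMap.mulLeft_apply, LinearMap.mulRight_apply,
      map_mul, Module.End.mul_apply, homL_ι, h3, polyRep_homL_inclU_mon]
    simp [add_comm]
  refine poly_ext fun i j => ?_
  rw [map_smul, coeffAt_mon]
  by_cases hij : 0 = i ∧ d = j
  · obtain ⟨rfl, rfl⟩ := hij
    rw [h2, map_add, coeffAt_polyRep_f, map_smul, coeffAt_mon, add_zero]
  · rw [if_neg hij, smul_zero]
    by_cases hd' : i + j = 0 + d
    · have h3 := congrArg (coeffAt i j) hw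
      rw [coeffAt_polyRep_h, map_smul, smul_eq_mul, ← sub_eq_zero, ← sub_mul] at h3
      refine (mul_eq_zero.1 h3).resolve_left fun h4 => ?_
      have h5 : (d : ℂ) = i + j := by exact_mod_cast (by omega : d = i + j)
      have h6 : (i : ℂ) = 0 := by rw [h5] at h4; linear_combination (-1 / 2 : ℂ) * h4
      have h7 : i = 0 := by exact_mod_cast h6
      omega
    · exact coeffAt_eq_zero hd hd'

/-- Harish-Chandra: a central element `z` acts through `R` of its Harish-Chandra projection. -/
theorem homL_center (z : Z𝔤) : homL z = homR (γHC z) := by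
  obtain ⟨P, hP⟩ := exists_poly (γHC z)
  apply polyRep_injective
  refine poly_hom_ext fun i j => ?_
  rw [hP, polyRep_homR_mon]
  -- `x₁^i x₂^j` is a multiple of `L_f^i x₂^(i + j)`
  have h1 := polyRep_f_pow_mon i 0 (i + j)
  rw [zero_add, Nat.add_sub_cancel_left] at h1
  have h2 : ((-1) ^ i * ((i + j).descFactorial i : ℂ)) ≠ 0 := by
    refine mul_ne_zero (pow_ne_zero _ (by simp)) (Nat.cast_ne_zero.2 ?_)
    rw [Ne, Nat.descFactorial_eq_zero_iff_lt]
    omega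
  have h3 := congrArg (fun u => polyRep (homL u) (mon 0 (i + j)))
    (Subalgebra.mem_center_iff.1 z.2 (ι𝔤 f ^ i))
  simp only [map_mul, map_pow, homL_ι, Module.End.mul_apply] at h3
  rw [h1, polyRep_homL_center_highest z hP, map_smul, map_smul, h1, smul_comm] at h3
  have h4 := smul_right_injective _ h2 h3
  rw [← h4]
  push_cast
  rfl

theorem homR_comm (c : U𝔥) (θ : GlobalDTilde) : Commute (homR c) θ := by
  obtain ⟨P, rfl⟩ := exists_poly c
  rw [← Polynomial.aeval_algHom_apply, homR_ι, vecR_h]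
  induction P using Polynomial.induction_on' with
  | add p q hp hq => rw [map_add]; exact hp.add_left hq
  | monomial n a =>
    rw [Polynomial.aeval_monomial]
    exact Commute.mul_left (Algebra.commutes a θ) ((euler_comm θ).pow_left n)

/-- The algebra structure of `Γ(X, 𝒟̃)` over `Z(𝔤)`. -/
abbrev centerAlgebra : Algebra Z𝔤 GlobalDTilde :=
  (homL.toRingHom.comp Z𝔤.val.toRingHom).toAlgebra' fun z θ => by
    change homL z * θ = θ * homL z
    rw [homL_center]
    exact homR_comm _ θ

/-- The homomorphism `u ⊗ c ↦ L_u R_c` of rings. -/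
def alphaRing : Utilde →+* GlobalDTilde :=
  letI := centerAlgebra
  let l : U𝔤 →ₐ[Z𝔤] GlobalDTilde := { homL.toRingHom with commutes' := fun _ => rfl }
  let r : U𝔥 →ₐ[Z𝔤] GlobalDTilde :=
    { homR.toRingHom with commutes' := fun z => (homL_center z).symm }
  (Algebra.TensorProduct.lift l r fun u c => (homR_comm c (homL u)).symm).toRingHom

theorem alphaRing_tmul (u : U𝔤) (c : U𝔥) : alphaRing (u ⊗ₜ c) = homL u * homR c := rfl

/-- The homomorphism `α : u ⊗ c ↦ L_u R_c` of `ℂ`-algebras. -/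
def alpha : Utilde →ₐ[ℂ] GlobalDTilde :=
  { alphaRing with
    commutes' := fun c => by
      change alphaRing (algebraMap ℂ U𝔤 c ⊗ₜ 1) = _
      rw [alphaRing_tmul, map_one, mul_one, AlgHom.commutes] }

theorem alpha_tmul (u : U𝔤) (c : U𝔥) : alpha (u ⊗ₜ c) = homL u * homR c := alphaRing_tmul u c

theorem alpha_ι_tmul_one (x : 𝔤) : alpha (ι𝔤 x ⊗ₜ 1) = vecL x := by
  rw [alpha_tmul, map_one, mul_one, homL_ι]

theorem alpha_one_tmul_ι (y : 𝔥) : alpha (1 ⊗ₜ ι𝔥 y) = vecR y := by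
  rw [alpha_tmul, map_one, one_mul, homR_ι]

theorem isAlpha_alpha : IsAlpha alpha :=
  ⟨fun x => by rw [alpha_ι_tmul_one]; exact isL_vecL x,
    fun y => by rw [alpha_one_tmul_ι]; exact isR_vecR y⟩

/-! ### Generators of the extended enveloping algebra -/

/-- The defining relation of the tensor product over `Z(𝔤)`. -/
theorem center_tmul_one (z : Z𝔤) : ((z : U𝔤) ⊗ₜ 1 : Utilde) = 1 ⊗ₜ γHC z := by
  have h1 : z • (1 : U𝔤) = z := mul_one (z : U𝔤)
  have h2 : z • (1 : U𝔥) = γHC z := mul_one (γHC z)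
  rw [← h2, ← TensorProduct.smul_tmul, h1]

/-- The scalars of `U(𝔥)` come from `Z(𝔤)`, so that both factors of `Ũ` induce the same
`ℂ`-algebra structure. -/
theorem one_tmul_algebraMap (a : ℂ) :
    (1 ⊗ₜ algebraMap ℂ U𝔥 a : Utilde) = algebraMap ℂ Utilde a := by
  have h1 := center_tmul_one (algebraMap ℂ Z𝔤 a)
  have h2 : γHC (algebraMap ℂ Z𝔤 a) = algebraMap ℂ U𝔥 a := γZ.commutes a
  rw [h2] at h1
  exact h1.symm

/-- A subspace of `Ũ` containing `1` and stable under multiplication by the generators `x ⊗ 1` and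
`1 ⊗ h` is everything. -/
theorem utilde_eq_top {M : Submodule ℂ Utilde} (h1 : 1 ∈ M)
    (hx : ∀ x, ∀ t ∈ M, (ι𝔤 x ⊗ₜ 1 : Utilde) * t ∈ M)
    (hy : ∀ t ∈ M, (1 ⊗ₜ ι𝔥 h𝔥 : Utilde) * t ∈ M) : M = ⊤ := by
  have hu : ∀ u ∈ (⊤ : Subalgebra ℂ U𝔤), ∀ t ∈ M, (u ⊗ₜ 1 : Utilde) * t ∈ M := by
    rw [← adjoin_ι]
    intro u hu
    induction hu using Algebra.adjoin_induction with
    | mem u hu => obtain ⟨x, rfl⟩ := hu; exact hx x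
    | algebraMap r =>
      intro t ht
      change algebraMap ℂ Utilde r * t ∈ M
      rw [← Algebra.smul_def]; exact M.smul_mem r ht
    | add a b _ _ ha hb =>
      intro t ht; rw [TensorProduct.add_tmul, add_mul]; exact M.add_mem (ha t ht) (hb t ht)
    | mul a b _ _ ha hb =>
      intro t ht
      have : (a * b) ⊗ₜ[Z𝔤] (1 : U𝔥) = a ⊗ₜ 1 * b ⊗ₜ 1 := by
        rw [Algebra.TensorProduct.tmul_mul_tmul, one_mul]
      rw [this, mul_assoc]; exact ha _ (hb t ht)
  have hc : ∀ (c : U𝔥), ∀ t ∈ M, (1 ⊗ₜ c : Utilde) * t ∈ M := by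
    intro c
    obtain ⟨P, rfl⟩ := exists_poly c
    induction P using Polynomial.induction_on with
    | C a =>
      intro t ht
      rw [Polynomial.aeval_C, one_tmul_algebraMap, ← Algebra.smul_def]
      exact M.smul_mem a ht
    | add p q hp hq =>
      intro t ht
      rw [map_add, TensorProduct.tmul_add, add_mul]; exact M.add_mem (hp t ht) (hq t ht)
    | monomial n a hn =>
      intro t ht
      rw [pow_succ, ← mul_assoc, map_mul, Polynomial.aeval_X]
      have : ∀ c : U𝔥, (1 : U𝔤) ⊗ₜ[Z𝔤] (c * ι𝔥 h𝔥) = 1 ⊗ₜ c * 1 ⊗ₜ ι𝔥 h𝔥 := by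
        intro c
        rw [Algebra.TensorProduct.tmul_mul_tmul, one_mul]
      rw [this, mul_assoc]
      exact hn _ (hy t ht)
  rw [eq_top_iff]
  intro t _
  induction t using TensorProduct.induction_on with
  | zero => exact M.zero_mem
  | add a b ha hb => exact M.add_mem (ha trivial) (hb trivial)
  | tmul u c =>
    have : u ⊗ₜ[Z𝔤] c = u ⊗ₜ 1 * (1 ⊗ₜ c * 1) := by
      rw [mul_one, Algebra.TensorProduct.tmul_mul_tmul, one_mul, mul_one]
    rw [this]
    exact hu u trivial _ (hc c _ h1)

/-- Twice the Casimir element `ef + fe + h²/2`, with `ef` rewritten as `fe + h`. -/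
def casimir : U𝔤 := (4 : ℂ) • (ι𝔤 f * ι𝔤 e) + ι𝔤 h * ι𝔤 h + (2 : ℂ) • ι𝔤 h

theorem casimir_mem : casimir ∈ Z𝔤 := by
  have r1 := comm_e_f
  have r2 := comm_h_e
  have r3 := comm_h_f
  have hsmul : ∀ (c : ℂ) (u : U𝔤), c • u = algebraMap ℂ U𝔤 c * u := fun c u => Algebra.smul_def c u
  have hc4 : algebraMap ℂ U𝔤 4 = 4 := map_ofNat _ 4
  have hc2 : algebraMap ℂ U𝔤 2 = 2 := map_ofNat _ 2
  have hcm2 : algebraMap ℂ U𝔤 (-2) = -2 := by rw [map_neg, hc2]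
  simp only [hsmul, hc2, hcm2] at r2 r3
  have hC : casimir = 4 * (ι𝔤 f * ι𝔤 e) + ι𝔤 h * ι𝔤 h + 2 * ι𝔤 h := by
    simp only [casimir, hsmul, hc2, hc4]
  have he : Commute casimir (ι𝔤 e) := by
    change _ = _
    rw [hC]
    generalize ι𝔤 e = E at *
    generalize ι𝔤 f = F at *
    generalize ι𝔤 h = K at *
    linear_combination (norm := noncomm_ring) -4 * (r1 * E) + K * r2 + r2 * K
  have hf : Commute casimir (ι𝔤 f) := by
    change _ = _
    rw [hC]
    generalize ι𝔤 e = E at *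
    generalize ι𝔤 f = F at *
    generalize ι𝔤 h = K at *
    linear_combination (norm := noncomm_ring) 4 * (F * r1) + K * r3 + r3 * K
  have hh : Commute casimir (ι𝔤 h) := by
    change _ = _
    rw [hC]
    generalize ι𝔤 e = E at *
    generalize ι𝔤 f = F at *
    generalize ι𝔤 h = K at *
    linear_combination (norm := noncomm_ring) -4 * (r3 * E) - 4 * (F * r2)
  refine Subalgebra.mem_center_iff.2 fun u => ?_
  have hu : u ∈ Algebra.adjoin ℂ (Set.range (UniversalEnvelopingAlgebra.ι ℂ : 𝔤 → U𝔤)) := by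
    rw [adjoin_ι]; trivial
  suffices Commute casimir u from this.symm
  induction hu using Algebra.adjoin_induction with
  | mem u hu =>
    obtain ⟨x, rfl⟩ := hu
    have : UniversalEnvelopingAlgebra.ι ℂ x =
        x.1 0 1 • ι𝔤 e + x.1 1 0 • ι𝔤 f + x.1 0 0 • ι𝔤 h := by
      conv_lhs => rw [eq_basis x]
      simp only [map_add, map_smul]
    rw [this]
    exact ((he.smul_right _).add_right (hf.smul_right _)).add_right (hh.smul_right _)
  | algebraMap r => exact (Algebra.commutes r casimir).symm
  | add a b _ _ ha hb => exact ha.add_right hb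
  | mul a b _ _ ha hb => exact ha.mul_right hb

theorem γHC_casimir : γHC casimir = ι𝔥 h𝔥 * ι𝔥 h𝔥 + (2 : ℂ) • ι𝔥 h𝔥 := by
  apply γHC_eq
  rw [map_add, map_mul, map_smul, inclU_ι]
  refine Submodule.mem_sup_left ⟨(4 : ℂ) • ι𝔤 e, ?_⟩
  rw [LinearMap.mulLeft_apply, casimir, mul_smul_comm]
  change _ = _ - (ι𝔤 h * ι𝔤 h + (2 : ℂ) • ι𝔤 h)
  abel

/-- The image `e ⊗ 1` of `e ∈ 𝔤` in `Ũ`. -/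
def tE : Utilde := ι𝔤 e ⊗ₜ 1

/-- The image `f ⊗ 1` of `f ∈ 𝔤` in `Ũ`. -/
def tF : Utilde := ι𝔤 f ⊗ₜ 1

/-- The image `h ⊗ 1` of `h ∈ 𝔤` in `Ũ`. -/
def tK : Utilde := ι𝔤 h ⊗ₜ 1

/-- The image `1 ⊗ h` of `h ∈ 𝔥` in `Ũ`. -/
def tH : Utilde := 1 ⊗ₜ ι𝔥 h𝔥

/-- The preimage `(H - h) / 2` of `x₁∂₁` in `Ũ`. -/
def tP : Utilde := (2⁻¹ : ℂ) • (tH - tK)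

/-- The preimage `(H + h) / 2` of `x₂∂₂` in `Ũ`. -/
def tQ : Utilde := (2⁻¹ : ℂ) • (tH + tK)

theorem tH_comm (t : Utilde) : Commute tH t := by
  induction t using TensorProduct.induction_on with
  | zero => exact Commute.zero_right _
  | add a b ha hb => exact ha.add_right hb
  | tmul u c =>
    change _ = _
    rw [tH, Algebra.TensorProduct.tmul_mul_tmul, Algebra.TensorProduct.tmul_mul_tmul, one_mul,
      mul_one, U𝔥_mul_comm]

theorem tE_mul_tF : tE * tF = tF * tE + tK := by
  simp only [tE, tF, tK, Algebra.TensorProduct.tmul_mul_tmul, comm_e_f, TensorProduct.add_tmul,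
    mul_one]

theorem tK_mul_tE : tK * tE = tE * tK + (2 : ℂ) • tE := by
  simp only [tE, tK, Algebra.TensorProduct.tmul_mul_tmul, comm_h_e, TensorProduct.add_tmul,
    mul_one]
  rfl

theorem tK_mul_tF : tK * tF = tF * tK + (-2 : ℂ) • tF := by
  simp only [tF, tK, Algebra.TensorProduct.tmul_mul_tmul, comm_h_f, TensorProduct.add_tmul,
    mul_one]
  rfl

theorem tP_comm_tQ : tP * tQ = tQ * tP := by
  have h1 := (tH_comm tK).eq
  simp only [tP, tQ, smul_mul_smul_comm, sub_mul, mul_add, add_mul, mul_sub, h1]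
  module

theorem tF_mul_tP : tF * tP = (tP - 1) * tF := by
  have h1 := (tH_comm tF).eq
  simp only [tP, mul_smul_comm, smul_mul_assoc, sub_mul, mul_sub, h1, tK_mul_tF, one_mul]
  module

theorem tF_mul_tQ : tF * tQ = (tQ + 1) * tF := by
  have h1 := (tH_comm tF).eq
  simp only [tQ, mul_smul_comm, smul_mul_assoc, add_mul, mul_add, h1, tK_mul_tF, one_mul]
  module

theorem tE_mul_tP : tE * tP = (tP + 1) * tE := by
  have h1 := (tH_comm tE).eq
  simp only [tP, mul_smul_comm, smul_mul_assoc, sub_mul, add_mul, mul_sub, h1, tK_mul_tE, one_mul]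
  module

theorem tE_mul_tQ : tE * tQ = (tQ - 1) * tE := by
  have h1 := (tH_comm tE).eq
  simp only [tQ, mul_smul_comm, smul_mul_assoc, sub_mul, add_mul, mul_add, h1, tK_mul_tE, one_mul]
  module

/-- The Casimir element is central, so that `4fe + h² + 2h = H² + 2H` in `Ũ`. -/
theorem tF_mul_tE : tF * tE = tP + tP * tQ := by
  have h1 := center_tmul_one ⟨casimir, casimir_mem⟩
  have h2 : (casimir ⊗ₜ 1 : Utilde) = (4 : ℂ) • (tF * tE) + tK * tK + (2 : ℂ) • tK := by
    simp only [casimir, tE, tF, tK, Algebra.TensorProduct.tmul_mul_tmul, TensorProduct.add_tmul,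
      mul_one]
    rfl
  have h3 : (1 ⊗ₜ γHC casimir : Utilde) = tH * tH + (2 : ℂ) • tH := by
    have h4 : (1 ⊗ₜ ((2 : ℂ) • ι𝔥 h𝔥) : Utilde) = (2 : ℂ) • tH := by
      rw [two_smul, two_smul, TensorProduct.tmul_add]; rfl
    rw [γHC_casimir, TensorProduct.tmul_add, h4, tH, Algebra.TensorProduct.tmul_mul_tmul, one_mul]
  have h5 : (4 : ℂ) • (tF * tE) + tK * tK + (2 : ℂ) • tK = tH * tH + (2 : ℂ) • tH :=
    h2.symm.trans (h1.trans h3)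
  have h6 : tF * tE = (4⁻¹ : ℂ) • (tH * tH + (2 : ℂ) • tH - tK * tK - (2 : ℂ) • tK) := by
    rw [← h5]; module
  have h7 := (tH_comm tK).eq
  rw [h6]
  simp only [tP, tQ, smul_mul_smul_comm, sub_mul, mul_add, h7]
  module

theorem tE_mul_tF' : tE * tF = tQ + tP * tQ := by
  have h1 : tK = tQ - tP := by simp only [tP, tQ]; module
  rw [tE_mul_tF, tF_mul_tE, h1]
  abel

theorem alpha_tE : alpha tE = -coordOp 1 0 := (alpha_ι_tmul_one e).trans vecL_e
theorem alpha_tF : alpha tF = -coordOp 0 1 := (alpha_ι_tmul_one f).trans vecL_f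
theorem alpha_tK : alpha tK = -coordOp 0 0 + coordOp 1 1 := (alpha_ι_tmul_one h).trans vecL_h
theorem alpha_tH : alpha tH = euler := (alpha_one_tmul_ι h𝔥).trans vecR_h

theorem alpha_tP : alpha tP = coordOp 0 0 := by
  rw [tP, map_smul, map_sub, alpha_tH, alpha_tK, euler]; module

theorem alpha_tQ : alpha tQ = coordOp 1 1 := by
  rw [tQ, map_smul, map_add, alpha_tH, alpha_tK, euler]; module

theorem alpha_surjective : Function.Surjective alpha := by
  rw [← AlgHom.range_eq_top, eq_top_iff, ← adjoin_coordOp, Algebra.adjoin_le_iff]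
  rintro _ ⟨⟨i, j⟩, rfl⟩
  fin_cases i <;> fin_cases j
  · exact ⟨tP, alpha_tP⟩
  · exact ⟨-tF, by rw [map_neg]; exact (congrArg _ alpha_tF).trans (neg_neg _)⟩
  · exact ⟨-tE, by rw [map_neg]; exact (congrArg _ alpha_tE).trans (neg_neg _)⟩
  · exact ⟨tQ, alpha_tQ⟩

theorem isAlpha_unique {β : Utilde →ₐ[ℂ] GlobalDTilde} (hβ : IsAlpha β) : β = alpha := by
  have h1 : (AlgHom.equalizer β alpha).toSubmodule = ⊤ := by
    refine utilde_eq_top (one_mem (AlgHom.equalizer β alpha)) (fun x t ht => ?_) fun t ht => ?_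
    · exact mul_mem (s := AlgHom.equalizer β alpha) ((hβ.1 x).unique (isAlpha_alpha.1 x)) ht
    · exact mul_mem (s := AlgHom.equalizer β alpha) ((hβ.2 h𝔥).unique (isAlpha_alpha.2 h𝔥)) ht
  refine AlgHom.ext fun t => ?_
  have h2 : t ∈ (AlgHom.equalizer β alpha).toSubmodule := by rw [h1]; trivial
  exact h2

/-! ### Injectivity of `α` -/

/-- The element of `Ũ` of weight `s ∈ ℤ`: a power of `f` if `s ≥ 0`, a power of `e` otherwise. -/
def tG (s : ℤ) : Utilde := tF ^ s.toNat * tE ^ (-s).toNat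

/-- The polynomial `q(P, Q)` in the commuting elements `P` and `Q`. -/
def polyPQ : Poly →ₗ[ℂ] Utilde :=
  (MvPolynomial.basisMonomials (Fin 2) ℂ).constr ℂ fun m => tP ^ m 0 * tQ ^ m 1

theorem polyPQ_mon (i j : ℕ) : polyPQ (mon i j) = tP ^ i * tQ ^ j := by
  have h1 : mon i j = MvPolynomial.basisMonomials (Fin 2) ℂ
      (Finsupp.equivFunOnFinite.symm ![i, j]) := by
    rw [MvPolynomial.coe_basisMonomials]
    beta_reduce
    rw [monomial_eq_smul_mon]
    simp
  rw [h1, polyPQ, Module.Basis.constr_basis]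
  simp

/-- The normal forms `∑ₛ qₛ(P, Q) gₛ`, with `gₛ` a power of `f` or of `e`. -/
def normalForm : (ℤ →₀ Poly) →ₗ[ℂ] Utilde :=
  Finsupp.lsum ℂ fun s => LinearMap.mulRight ℂ (tG s) ∘ₗ polyPQ

theorem normalForm_apply (l : ℤ →₀ Poly) :
    normalForm l = l.sum fun s q => polyPQ q * tG s := rfl

theorem mul_tG_mem (s : ℤ) (q : Poly) : polyPQ q * tG s ∈ LinearMap.range normalForm :=
  ⟨Finsupp.single s q, by rw [normalForm_apply, Finsupp.sum_single_index (by simp)]⟩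

/-- Stability of the normal forms under left multiplication needs to be checked on the
`P^i Q^j gₛ` only. -/
theorem mul_mem_of_forall (x : Utilde)
    (hx : ∀ i j s, x * (tP ^ i * tQ ^ j * tG s) ∈ LinearMap.range normalForm) :
    ∀ t ∈ LinearMap.range normalForm, x * t ∈ LinearMap.range normalForm := by
  rintro _ ⟨l, rfl⟩
  have hq : ∀ s q, x * (polyPQ q * tG s) ∈ LinearMap.range normalForm := by
    intro s q
    induction q using MvPolynomial.induction_on' with
    | monomial u a =>
      rw [monomial_eq_smul_mon, map_smul, polyPQ_mon, smul_mul_assoc, mul_smul_comm]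
      exact Submodule.smul_mem _ _ (hx _ _ _)
    | add p q hp hq => rw [map_add, add_mul, mul_add]; exact add_mem hp hq
  rw [normalForm_apply, Finsupp.sum, Finset.mul_sum]
  exact sum_mem fun s _ => hq s _

theorem pow_mul_tG_mem (i j : ℕ) (s : ℤ) :
    tP ^ i * tQ ^ j * tG s ∈ LinearMap.range normalForm := by
  rw [← polyPQ_mon]; exact mul_tG_mem s _

theorem tP_mul_mem : ∀ t ∈ LinearMap.range normalForm, tP * t ∈ LinearMap.range normalForm :=
  mul_mem_of_forall _ fun i j s => by
    rw [← mul_assoc, ← mul_assoc, ← pow_succ']; exact pow_mul_tG_mem _ _ _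

theorem tQ_mul_mem : ∀ t ∈ LinearMap.range normalForm, tQ * t ∈ LinearMap.range normalForm :=
  mul_mem_of_forall _ fun i j s => by
    have h1 : Commute tQ (tP ^ i) := Commute.pow_right tP_comm_tQ.symm i
    rw [← mul_assoc, ← mul_assoc, h1.eq, mul_assoc (tP ^ i), ← pow_succ']
    exact pow_mul_tG_mem _ _ _

/-- Stability under an element that commutes with `P` and `Q` up to shifts by constants needs to be
checked on the `gₛ` only. -/
theorem mul_mem_of_shift {x : Utilde} {a b : ℂ} (hP : x * tP = (tP + algebraMap ℂ _ a) * x)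
    (hQ : x * tQ = (tQ + algebraMap ℂ _ b) * x)
    (hG : ∀ s, x * tG s ∈ LinearMap.range normalForm) :
    ∀ t ∈ LinearMap.range normalForm, x * t ∈ LinearMap.range normalForm := by
  have hshift : ∀ (y : Utilde) (c : ℂ) (t : Utilde),
      (∀ t ∈ LinearMap.range normalForm, y * t ∈ LinearMap.range normalForm) →
      t ∈ LinearMap.range normalForm →
      (y + algebraMap ℂ _ c) * t ∈ LinearMap.range normalForm := by
    intro y c t hy ht
    rw [add_mul, ← Algebra.smul_def]
    exact add_mem (hy t ht) (Submodule.smul_mem _ _ ht)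
  refine mul_mem_of_forall x fun i j s => ?_
  induction i with
  | zero =>
    rw [pow_zero, one_mul]
    induction j with
    | zero => rw [pow_zero, one_mul]; exact hG s
    | succ j ih =>
      rw [pow_succ', mul_assoc, ← mul_assoc x, hQ, mul_assoc]
      exact hshift _ _ _ tQ_mul_mem ih
  | succ i ih =>
    rw [pow_succ', mul_assoc, mul_assoc, ← mul_assoc x, hP, mul_assoc, ← mul_assoc (tP ^ i)]
    exact hshift _ _ _ tP_mul_mem ih

theorem tG_mem (s : ℤ) : tG s ∈ LinearMap.range normalForm := by
  simpa using pow_mul_tG_mem 0 0 s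

theorem tG_natCast (n : ℕ) : tG n = tF ^ n := by simp [tG]

theorem tG_neg_natCast (n : ℕ) : tG (-n) = tE ^ n := by simp [tG]

theorem tF_mul_mem : ∀ t ∈ LinearMap.range normalForm, tF * t ∈ LinearMap.range normalForm := by
  refine mul_mem_of_shift (a := -1) (b := 1) (by rw [tF_mul_tP, map_neg, map_one, sub_eq_add_neg])
    (by rw [tF_mul_tQ, map_one]) fun s => ?_
  obtain ⟨n, rfl | rfl⟩ := s.eq_nat_or_neg
  · rw [tG_natCast, ← pow_succ', ← tG_natCast]; exact tG_mem _
  · rcases n with _ | n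
    · have := tG_mem (1 : ℕ)
      rw [tG_natCast] at this
      simpa [tG] using this
    · rw [tG_neg_natCast, pow_succ', ← mul_assoc, tF_mul_tE, add_mul, mul_assoc, ← tG_neg_natCast]
      exact add_mem (tP_mul_mem _ (tG_mem _)) (tP_mul_mem _ (tQ_mul_mem _ (tG_mem _)))

theorem tE_mul_mem : ∀ t ∈ LinearMap.range normalForm, tE * t ∈ LinearMap.range normalForm := by
  refine mul_mem_of_shift (a := 1) (b := -1) (by rw [tE_mul_tP, map_one])
    (by rw [tE_mul_tQ, map_neg, map_one, sub_eq_add_neg]) fun s => ?_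
  obtain ⟨n, rfl | rfl⟩ := s.eq_nat_or_neg
  · rcases n with _ | n
    · have := tG_mem (-(1 : ℕ))
      rw [tG_neg_natCast] at this
      simpa [tG] using this
    · rw [tG_natCast, pow_succ', ← mul_assoc, tE_mul_tF', add_mul, mul_assoc, ← tG_natCast]
      exact add_mem (tQ_mul_mem _ (tG_mem _)) (tP_mul_mem _ (tQ_mul_mem _ (tG_mem _)))
  · rw [tG_neg_natCast, ← pow_succ', ← tG_neg_natCast]; exact tG_mem _

/-- Every element of `Ũ` has a normal form. -/
theorem normalForm_range : LinearMap.range normalForm = ⊤ := by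
  have hK : tK = tQ - tP := by simp only [tP, tQ]; module
  have hH : tH = tQ + tP := by simp only [tP, tQ]; module
  refine utilde_eq_top (by simpa [tG] using tG_mem 0) (fun x t ht => ?_) fun t ht => ?_
  · have : (ι𝔤 x ⊗ₜ 1 : Utilde) = x.1 0 1 • tE + x.1 1 0 • tF + x.1 0 0 • tK := by
      conv_lhs => rw [eq_basis x]
      simp only [map_add, map_smul, TensorProduct.add_tmul]
      rfl
    rw [this, hK, add_mul, add_mul, smul_mul_assoc, smul_mul_assoc, smul_mul_assoc, sub_mul]
    exact add_mem (add_mem (Submodule.smul_mem _ _ (tE_mul_mem t ht))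
      (Submodule.smul_mem _ _ (tF_mul_mem t ht)))
      (Submodule.smul_mem _ _ (sub_mem (tQ_mul_mem t ht) (tP_mul_mem t ht)))
  · change tH * t ∈ _
    rw [hH, add_mul]
    exact add_mem (tQ_mul_mem t ht) (tP_mul_mem t ht)

/-- `P` and `Q` act as `x₁∂₁` and `x₂∂₂`, with the monomials as eigenvectors. -/
theorem polyRep_polyPQ (q : Poly) (i j : ℕ) : polyRep (alpha (polyPQ q)) (mon i j) =
    MvPolynomial.eval ![(i : ℂ), (j : ℂ)] q • mon i j := by
  have hP : ∀ k, (polyRep (coordOp 0 0) ^ k) (mon i j) = (i : ℂ) ^ k • mon i j := by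
    intro k
    induction k with
    | zero => simp
    | succ k ih =>
      rw [pow_succ, Module.End.mul_apply, polyRep_coordOp_zero_mon, map_smul, ih, smul_smul,
        pow_succ']
  have hQ : ∀ k, (polyRep (coordOp 1 1) ^ k) (mon i j) = (j : ℂ) ^ k • mon i j := by
    intro k
    induction k with
    | zero => simp
    | succ k ih =>
      rw [pow_succ, Module.End.mul_apply, polyRep_coordOp_one_mon, map_smul, ih, smul_smul,
        pow_succ']
  induction q using MvPolynomial.induction_on' with
  | monomial u a =>
    rw [monomial_eq_smul_mon, map_smul, polyPQ_mon]
    have h1 : MvPolynomial.eval ![(i : ℂ), (j : ℂ)] (mon (u 0) (u 1)) =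
        (i : ℂ) ^ u 0 * (j : ℂ) ^ u 1 := by simp [mon]
    rw [MvPolynomial.smul_eval, h1]
    simp only [map_smul, map_mul, map_pow, alpha_tP, alpha_tQ, LinearMap.smul_apply,
      Module.End.mul_apply, hQ, hP, smul_smul]
    congr 1
    ring
  | add p q hp hq => simp only [map_add, LinearMap.add_apply, hp, hq, add_smul]

theorem polyRep_tG_mon (s : ℤ) (i j : ℕ) : polyRep (alpha (tG s)) (mon i j) =
    ((-1) ^ (-s).toNat * (i.descFactorial (-s).toNat : ℂ) *
      ((-1) ^ s.toNat * ((j + (-s).toNat).descFactorial s.toNat : ℂ))) •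
      mon (i - (-s).toNat + s.toNat) (j + (-s).toNat - s.toNat) := by
  rw [tG, map_mul, map_pow, map_pow, map_mul, map_pow, map_pow, alpha_tE, alpha_tF, ← vecL_e,
    ← vecL_f, Module.End.mul_apply, polyRep_e_pow_mon, map_smul, polyRep_f_pow_mon, smul_smul]

/-- The images of the normal forms `∑ₛ qₛ(P, Q) gₛ` are independent.  As `gₛ` maps a monomial to a
multiple of the monomial with exponents shifted by `(s, -s)`, the coefficient of `x₁^i x₂^j` in the
image of `x₁^(i - s₀) x₂^(j + s₀)` is a nonzero multiple of `qₛ₀(i, j)`, for all large `i` and `j`. -/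
theorem alpha_normalForm_injective {l : ℤ →₀ Poly} (hl : alpha (normalForm l) = 0) : l = 0 := by
  refine Finsupp.ext fun s₀ => ?_
  have key : ∀ i j : ℕ, s₀.toNat ≤ i → (-s₀).toNat ≤ j →
      MvPolynomial.eval ![(i : ℂ), (j : ℂ)] (l s₀) = 0 := by
    intro i j hi hj
    have hterm : ∀ s, coeffAt i j (polyRep (alpha (polyPQ (l s) * tG s))
        (mon (i - s₀.toNat + (-s₀).toNat) (j - (-s₀).toNat + s₀.toNat))) = if s = s₀ then
        (-1) ^ (-s).toNat * ((i - s₀.toNat + (-s₀).toNat).descFactorial (-s).toNat : ℂ) *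
        ((-1) ^ s.toNat *
          ((j - (-s₀).toNat + s₀.toNat + (-s).toNat).descFactorial s.toNat : ℂ)) *
        MvPolynomial.eval ![(i : ℂ), (j : ℂ)] (l s) else 0 := by
      intro s
      rw [map_mul, map_mul, Module.End.mul_apply, polyRep_tG_mon, map_smul, polyRep_polyPQ,
        map_smul, map_smul, coeffAt_mon]
      split_ifs with h1 h2 h2
      · rw [h1.1, h1.2]; simp
      · -- the factor vanishes, since truncated subtraction is the only way to get equal exponents
        have h3 : i - s₀.toNat + (-s₀).toNat < (-s).toNat ∨
            j - (-s₀).toNat + s₀.toNat + (-s).toNat < s.toNat := by omega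
        rcases h3 with h3 | h3
        · simp [Nat.descFactorial_eq_zero_iff_lt.2 h3]
        · simp [Nat.descFactorial_eq_zero_iff_lt.2 h3]
      · exfalso; subst h2; omega
      · simp
    have h0 : coeffAt i j (polyRep (alpha (normalForm l))
        (mon (i - s₀.toNat + (-s₀).toNat) (j - (-s₀).toNat + s₀.toNat))) = 0 := by
      rw [hl, map_zero, LinearMap.zero_apply, map_zero]
    rw [normalForm_apply, Finsupp.sum, map_sum, map_sum, LinearMap.sum_apply, map_sum,
      Finset.sum_congr rfl fun s _ => hterm s, Finset.sum_ite_eq'] at h0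
    by_cases hs : s₀ ∈ l.support
    · rw [if_pos hs] at h0
      refine (mul_eq_zero.1 h0).resolve_left ?_
      have h1 : ∀ n k : ℕ, k ≤ n → (n.descFactorial k : ℂ) ≠ 0 := by
        intro n k hk
        rw [Nat.cast_ne_zero, Ne, Nat.descFactorial_eq_zero_iff_lt]
        omega
      have h2 : ∀ k : ℕ, ((-1 : ℂ)) ^ k ≠ 0 := fun k => pow_ne_zero k (by simp)
      exact mul_ne_zero (mul_ne_zero (h2 _) (h1 _ _ (by omega)))
        (mul_ne_zero (h2 _) (h1 _ _ (by omega)))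
    · rw [Finsupp.notMem_support_iff.1 hs, map_zero]
  let N := s₀.toNat + (-s₀).toNat
  refine MvPolynomial.funext_set (fun _ : Fin 2 => Set.range fun n : ℕ => ((n + N : ℕ) : ℂ))
    (fun _ => Set.infinite_range_of_injective fun a b hab => ?_) fun x hx => ?_
  · have : a + N = b + N := Nat.cast_injective hab
    omega
  · obtain ⟨a, ha⟩ := hx 0 trivial
    obtain ⟨b, hb⟩ := hx 1 trivial
    have h1 : x = ![((a + N : ℕ) : ℂ), ((b + N : ℕ) : ℂ)] := by
      ext k; fin_cases k
      · exact ha.symm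
      · exact hb.symm
    rw [h1, Finsupp.zero_apply, map_zero]
    exact key _ _ (by omega) (by omega)

theorem alpha_injective : Function.Injective alpha := by
  rw [injective_iff_map_eq_zero]
  intro t ht
  obtain ⟨l, rfl⟩ : t ∈ LinearMap.range normalForm := by rw [normalForm_range]; trivial
  rw [alpha_normalForm_injective ht, map_zero]

end SL2Loc
end
open scoped TensorProduct in
theorem mainTheorem2 :
    ∃ α : SL2Loc.Utilde →ₐ[ℂ] SL2Loc.GlobalDTilde,
      -- `α` is the map `g ⊗ g' ↦ L_g R_{g'}` (well defined, and uniquely determined by this)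
      SL2Loc.IsAlpha α ∧ (∀ β : SL2Loc.Utilde →ₐ[ℂ] SL2Loc.GlobalDTilde,
        SL2Loc.IsAlpha β → β = α) ∧
      -- `α` is an isomorphism
      Function.Bijective α ∧
      -- the operators `E i j = x_i ∂_j` generate, and match with `L_e`, `L_f`, `L_h`, `R_h`
      ∃ E : Fin 2 → Fin 2 → SL2Loc.GlobalDTilde,
        (∀ i j, SL2Loc.IsCoordOp i j (E i j)) ∧
        Algebra.adjoin ℂ (Set.range fun ij : Fin 2 × Fin 2 => E ij.1 ij.2) = ⊤ ∧
        α (SL2Loc.ι𝔤 SL2Loc.e ⊗ₜ 1) = -E 1 0 ∧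
        α (SL2Loc.ι𝔤 SL2Loc.f ⊗ₜ 1) = -E 0 1 ∧
        α (SL2Loc.ι𝔤 SL2Loc.h ⊗ₜ 1) = -E 0 0 + E 1 1 ∧
        α (1 ⊗ₜ SL2Loc.ι𝔥 SL2Loc.h𝔥) = E 0 0 + E 1 1 :=
  ⟨SL2Loc.alpha, SL2Loc.isAlpha_alpha, fun _ => SL2Loc.isAlpha_unique,
    ⟨SL2Loc.alpha_injective, SL2Loc.alpha_surjective⟩, SL2Loc.coordOp, SL2Loc.isCoordOp_coordOp,
    SL2Loc.adjoin_coordOp, SL2Loc.alpha_tE, SL2Loc.alpha_tF, SL2Loc.alpha_tK, SL2Loc.alpha_tH⟩
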